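/- Conventions. A quiver $Q=(Q_0,Q_1,s,r)$ is a directed graph; it is row-finite if every vertex emits only finitely many arrows. $T(u)$ is the set of vertices that can be reached from $u$ by a (possibly trivial) path. A vertex $u$ is a line point if no $w\in T(u)$ emits two or more arrows or has a cycle based at it; $P_l(Q)$ is the set of line points. A set $H\subseteq Q_0$ is hereditary if $r(e)\in H$ whenever $s(e)\in H$, and saturated if it contains each vertex $v$ that emits at least one and only finitely many arrows, all with range in $H$; $\overline{S}$ is the smallest hereditary saturated set containing $S$, and $Q\setminus H$ is the quiver of the vertices outside $H$ and the arrows between them. Put $P_l^1(Q)=P_l(Q)$, $P_l^{\alpha+1}(Q)=P_l^\alpha(Q)\cup P_l\bigl(Q\setminus\overline{P_l^\alpha(Q)}\bigr)$ for each ordinal $\alpha\ge 1$, $P_l^\beta(Q)=\bigcup_{1\le\alpha<\beta}P_l^\alpha(Q)$ for limit ordinals $\beta$, and $\overrightarrow{P_l}(Q)=\bigcup_\alpha P_l^\alpha(Q)$. For an algebra $A$, $\mathrm{Soc}(A)$ is the (left) socle, i.e. the sum of the minimal left ideals; $\mathrm{Soc}^1(A)=\mathrm{Soc}(A)$, $\mathrm{Soc}^{\alpha+1}(A)/\mathrm{Soc}^\alpha(A)=\mathrm{Soc}(A/\mathrm{Soc}^\alpha(A))$,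 $\mathrm{Soc}^\beta(A)=\sum_{1\le\alpha<\beta}\mathrm{Soc}^\alpha(A)$ for limit ordinals $\beta$, and $\overrightarrow{\mathrm{Soc}}(A)=\sum_\alpha\mathrm{Soc}^\alpha(A)$. $L_{\mathbb K}(Q)$ is the Leavitt path algebra of $Q$ over a field $\mathbb K$. Statement. Let $Q$ be a row-finite quiver, let $\mathbb K$ be a field, and put $H=\overline{P_l(Q)}$. (1) If $u\in P_l(Q\setminus H)$, then there is an arrow $f$ with $s(f)=u$, $r(f)\notin H$ and $r(f)\neq u$. (2) More generally, let $k\ge 1$ and let $u_1,\dots,u_k$ be pairwise different vertices outside $H$ such that for each $1\le i\le k-1$ there is an arrow from $u_i$ to $u_{i+1}$, and $u_1\in P_l(Q\setminus H)$. Then there is a vertex $u_{k+1}\notin\{u_1,\dots,u_k\}$ with $u_{k+1}\notin H$ and an arrow from $u_k$ to $u_{k+1}$. (3) If $Q_0$ is finite, then $P_l(Q\setminus H)=\emptyset$, $\overrightarrow{P_l}(Q)=P_l^1(Q)$, $\mathrm{Soc}^2(L_{\mathbb K}(Q))=\mathrm{Soc}^1(L_{\mathbb K}(Q))$ and $\overrightarrow{\mathrm{Soc}}(L_{\mathbb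 K}(Q))=\mathrm{Soc}^1(L_{\mathbb K}(Q))$. -/

import Mathlib

/-!
Quivers are Mathlib quivers: a type of vertices `V` with a type `a ⟶ b` of arrows for each pair
of vertices. `Quiver.Total V` is the type of all arrows, `Quiver.Star v` the type of the arrows
with source `v`.
-/

namespace LeavittQuiver

universe u v w

/-! ### Row-finite quivers, line points, hereditary saturated closures -/

section Combinatorics

variable (V : Type u) [Quiver.{v} V]

/-- Every vertex emits only finitely many arrows. -/
def RowFinite : Prop := ∀ a : V, Finite (Quiver.Star a)

variable {V}

/-- A vertex is regular if it emits at least one and only finitely many arrows. -/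
def IsRegularVertex (a : V) : Prop := Nonempty (Quiver.Star a) ∧ Finite (Quiver.Star a)

/-- A vertex is a bifurcation if it emits at least two arrows. -/
def IsBifurcation (a : V) : Prop := Nontrivial (Quiver.Star a)

/-- The tree `T(a)`: all vertices `b` such that there is a path (possibly trivial) from `a`
to `b`. -/
def tree (a : V) : Set V := {b | Nonempty (Quiver.Path a b)}

/-- A closed path `e₁ ⋯ eₙ` (`n ≥ 1`) is a cycle if the sources of `e₁, …, eₙ` are pairwise
different. The sources are all the vertices of the path except the last one. -/
def IsCycle {a : V} (p : Quiver.Path a a) : Prop :=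
  0 < p.length ∧ p.vertices.dropLast.Nodup

/-- There is a cycle at the vertex `a`. -/
def HasCycleAt (a : V) : Prop := ∃ p : Quiver.Path a a, IsCycle p

/-- A line point: there are neither bifurcations nor cycles at any vertex of its tree. -/
def IsLinePoint (a : V) : Prop := ∀ b ∈ tree a, ¬ IsBifurcation b ∧ ¬ HasCycleAt b

variable (V) in
/-- The set `P_l(Q)` of line points. -/
def linePoints : Set V := {a | IsLinePoint a}

/-- `H` is hereditary: ranges of arrows that start in `H` are in `H`. -/
def IsHereditary (H : Set V) : Prop := ∀ a ∈ H, ∀ b : V, (a ⟶ b) → b ∈ H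

/-- `H` is saturated: a regular vertex all of whose arrows end in `H` is in `H`. -/
def IsSaturated (H : Set V) : Prop :=
  ∀ a : V, IsRegularVertex a → (∀ b : V, (a ⟶ b) → b ∈ H) → a ∈ H

/-- The hereditary saturated closure: the smallest hereditary and saturated set that
contains `S`. -/
def hsClosure (S : Set V) : Set V := ⋂₀ {H | S ⊆ H ∧ IsHereditary H ∧ IsSaturated H}

/-- The vertex type of the quiver `Q ∖ H`. -/
def Remove (H : Set V) : Type u := {a : V // a ∉ H}

/-- The quiver `Q ∖ H`: the vertices outside `H`, and all arrows of `Q` between them. -/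
instance (H : Set V) : Quiver.{v} (Remove H) := ⟨fun a b => (a.1 ⟶ b.1)⟩

/-- The set `P_l(Q ∖ H)`, as a set of vertices of `Q`. -/
def linePointsOff (H : Set V) : Set V :=
  (fun a : Remove H => a.1) '' linePoints (Remove H)

end Combinatorics

section LinePointSeries

variable (V : Type u) [Quiver.{v} V]

open Classical in
/-- The sets `P_l^α(Q)` for ordinals `α ≥ 1`: `P_l^1(Q) = P_l(Q)`, the successor step adds
the line points of the quiver without the hereditary saturated closure of what is already there,
and at limit ordinals one takes the union. The indexing of the sequence starts at `1`;
the value at `0` is the empty set. -/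
noncomputable def linePointSeries (α : Ordinal.{u}) : Set V :=
  Ordinal.limitRecOn α ∅
    (fun α S => if α = 0 then linePoints V else S ∪ linePointsOff (hsClosure S))
    (fun β _ S => ⋃ (α : Ordinal.{u}) (h : α < β), S α h)

/-- The union of the sets `P_l^α(Q)` over all ordinals `α`. -/
noncomputable def linePointUnion : Set V := ⋃ α : Ordinal.{u}, linePointSeries V α

end LinePointSeries

/-! ### The socle of a (not necessarily unital) ring and its Loewy series -/

section Socle

/-- An additive subgroup that absorbs multiplication from the left. -/
def IsLeftIdeal {A : Type w} [NonUnitalRing A] (M : AddSubgroup A) : Prop :=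
  ∀ a : A, ∀ x ∈ M, a * x ∈ M

/-- A left ideal that is minimal among the nonzero left ideals. -/
def IsMinimalLeftIdeal {A : Type w} [NonUnitalRing A] (M : AddSubgroup A) : Prop :=
  Minimal (fun N : AddSubgroup A => IsLeftIdeal N ∧ N ≠ ⊥) M

variable (A : Type w) [NonUnitalRing A]

/-- The sum of all minimal left ideals, as an additive subgroup. -/
def socleAddSubgroup : AddSubgroup A := sSup {M | IsMinimalLeftIdeal M}

variable {A}

theorem mul_mem_left_socle (a x : A) (hx : x ∈ socleAddSubgroup A) :
    a * x ∈ socleAddSubgroup A := by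
  have h : socleAddSubgroup A ≤ (socleAddSubgroup A).comap (AddMonoidHom.mulLeft a) :=
    sSup_le fun M hM y hy => le_sSup (a := M) hM (hM.1.1 a y hy)
  exact h hx

theorem mul_mem_right_socle (x a : A) (hx : x ∈ socleAddSubgroup A) :
    x * a ∈ socleAddSubgroup A := by
  have h : socleAddSubgroup A ≤ (socleAddSubgroup A).comap (AddMonoidHom.mulRight a) := by
    refine sSup_le fun M hM => ?_
    rw [← AddSubgroup.map_le_iff_le_comap]
    by_cases h0 : M.map (AddMonoidHom.mulRight a) = ⊥
    · rw [h0]; exact bot_le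
    · refine le_sSup (a := M.map (AddMonoidHom.mulRight a)) ⟨⟨?_, h0⟩, ?_⟩
      · rintro b _ ⟨y, hy, rfl⟩
        exact ⟨b * y, hM.1.1 b y hy, by simp [mul_assoc]⟩
      · rintro N ⟨hN, hN0⟩ hle
        have key : M ≤ M ⊓ N.comap (AddMonoidHom.mulRight a) := by
          refine hM.2 ⟨?_, ?_⟩ inf_le_left
          · rintro b y ⟨hy, hy'⟩
            refine ⟨hM.1.1 b y hy, ?_⟩
            have := hN b _ hy'
            simpa [mul_assoc] using this
          · intro hbot
            apply hN0
            rw [eq_bot_iff]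
            intro z hz
            obtain ⟨y, hy, rfl⟩ := hle hz
            have hy0 : y ∈ M ⊓ N.comap (AddMonoidHom.mulRight a) := ⟨hy, hz⟩
            rw [hbot, AddSubgroup.mem_bot] at hy0
            simp [hy0]
        rintro _ ⟨y, hy, rfl⟩
        exact (key hy).2
  exact h hx

variable (A) in
/-- The (left) socle `Soc(A)`: the two-sided ideal that is the sum of all minimal left ideals
of `A`. -/
def socle : TwoSidedIdeal A :=
  TwoSidedIdeal.mk' (socleAddSubgroup A : Set A) (zero_mem _) (fun h h' => add_mem h h')
    (fun h => neg_mem h) (fun h => mul_mem_left_socle _ _ h) (fun h => mul_mem_right_socle _ _ h)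

/-- The quotient map from `A` to `A / I`. -/
def quotientMap (I : TwoSidedIdeal A) : A →ₙ+* I.ringCon.Quotient where
  toFun x := x
  map_mul' _ _ := rfl
  map_zero' := rfl
  map_add' _ _ := rfl

/-- The ideal `J` of `A` that contains `I` and satisfies `J / I = Soc(A / I)`. -/
def socleOver (I : TwoSidedIdeal A) : TwoSidedIdeal A :=
  TwoSidedIdeal.comap (quotientMap I) (socle I.ringCon.Quotient)

variable (A)

open Classical in
/-- The Loewy series of socles `Soc^α(A)` for ordinals `α ≥ 1`: `Soc^1(A) = Soc(A)`,
`Soc^(α+1)(A) / Soc^α(A) = Soc(A / Soc^α(A))`, and sums at limit ordinals. The indexing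
starts at `1`; the value at `0` is the zero ideal. -/
noncomputable def socleSeries (α : Ordinal.{w}) : TwoSidedIdeal A :=
  Ordinal.limitRecOn α ⊥
    (fun α I => if α = 0 then socle A else socleOver I)
    (fun β _ I => ⨆ (α : Ordinal.{w}) (h : α < β), I α h)

/-- The sum of the ideals `Soc^α(A)` over all ordinals `α`. -/
noncomputable def socleSum : TwoSidedIdeal A := ⨆ α : Ordinal.{w}, socleSeries A α

end Socle

/-! ### Leavitt path algebras -/

section Leavitt

variable (K : Type w) [Field K] (V : Type u) [Quiver.{v} V]

/-- The generators: vertices, arrows and ghost arrows. -/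
inductive Gen : Type (max u v)
  | vertex (a : V) : Gen
  | arrow (e : Quiver.Total V) : Gen
  | ghost (e : Quiver.Total V) : Gen

/-- The free associative (non-unital) `K`-algebra on the generators: its `K`-basis consists of
the nonempty words in the generators. -/
abbrev FreeAlg : Type (max u v w) := MonoidAlgebra K (FreeSemigroup (Gen V))

variable {V}

/-- The vertex `a` in the free algebra. -/
noncomputable def fVertex (a : V) : FreeAlg K V :=
  MonoidAlgebra.single (FreeSemigroup.of (Gen.vertex a)) 1

/-- The arrow `e` in the free algebra. -/
noncomputable def fArrow (e : Quiver.Total V) : FreeAlg K V :=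
  MonoidAlgebra.single (FreeSemigroup.of (Gen.arrow e)) 1

/-- The ghost arrow `e*` in the free algebra. -/
noncomputable def fGhost (e : Quiver.Total V) : FreeAlg K V :=
  MonoidAlgebra.single (FreeSemigroup.of (Gen.ghost e)) 1

/-- The arrow with source `a` that belongs to an element of the star of `a`. -/
def starArrow {a : V} (p : Quiver.Star a) : Quiver.Total V := ⟨a, p.1, p.2⟩

variable (V)

/-- The defining relations of the Leavitt path algebra. -/
inductive Rel : FreeAlg K V → FreeAlg K V → Prop
  | vertex_mul_self (a : V) : Rel (fVertex K a * fVertex K a) (fVertex K a)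
  | vertex_mul_ne (a b : V) (h : a ≠ b) : Rel (fVertex K a * fVertex K b) 0
  | source_arrow (e : Quiver.Total V) : Rel (fVertex K e.left * fArrow K e) (fArrow K e)
  | arrow_range (e : Quiver.Total V) : Rel (fArrow K e * fVertex K e.right) (fArrow K e)
  | range_ghost (e : Quiver.Total V) : Rel (fVertex K e.right * fGhost K e) (fGhost K e)
  | ghost_source (e : Quiver.Total V) : Rel (fGhost K e * fVertex K e.left) (fGhost K e)
  | ck1_self (e : Quiver.Total V) : Rel (fGhost K e * fArrow K e) (fVertex K e.right)
  | ck1_ne (e f : Quiver.Total V) (h : e ≠ f) : Rel (fGhost K e * fArrow K f) 0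
  | ck2 (a : V) (_ : Nonempty (Quiver.Star a)) (_ : Fintype (Quiver.Star a)) :
      Rel (fVertex K a)
        (∑ p : Quiver.Star a, fArrow K (starArrow p) * fGhost K (starArrow p))

/-- All scalar multiples of the defining relations. The ring congruence that they generate is
the smallest congruence of `K`-algebras that contains the defining relations. -/
def ScaledRel (x y : FreeAlg K V) : Prop :=
  ∃ (k : K) (x' y' : FreeAlg K V), Rel K V x' y' ∧ x = k • x' ∧ y = k • y'

/-- The congruence of `K`-algebras generated by the defining relations. -/
noncomputable def leavittCon : RingCon (FreeAlg K V) := ringConGen (ScaledRel K V)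

/-- The Leavitt path algebra `L_K(Q)`. -/
def LeavittPathAlgebra : Type (max u v w) := (leavittCon K V).Quotient

noncomputable instance : NonUnitalRing (LeavittPathAlgebra K V) :=
  inferInstanceAs (NonUnitalRing (leavittCon K V).Quotient)

theorem leavittCon_smul (k : K) {x y : FreeAlg K V} (h : leavittCon K V x y) :
    leavittCon K V (k • x) (k • y) := by
  change RingConGen.Rel (ScaledRel K V) x y at h
  change RingConGen.Rel (ScaledRel K V) (k • x) (k • y)
  induction h with
  | of x y h =>
    obtain ⟨l, x', y', h, rfl, rfl⟩ := h
    exact .of _ _ ⟨k * l, x', y', h, smul_smul _ _ _, smul_smul _ _ _⟩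
  | refl x => exact .refl _
  | symm _ ih => exact ih.symm
  | trans _ _ ih ih' => exact ih.trans ih'
  | add _ _ ih ih' => simpa only [smul_add] using ih.add ih'
  | mul _ h' ih _ => simpa only [smul_mul_assoc] using ih.mul h'

noncomputable instance : SMul K (LeavittPathAlgebra K V) :=
  ⟨fun k => Quotient.map' (fun x => k • x) fun _ _ h => leavittCon_smul K V k h⟩

/-- The quotient map from the free algebra. -/
noncomputable def toLeavitt : FreeAlg K V →+ LeavittPathAlgebra K V where
  toFun x := RingCon.toQuotient (c := leavittCon K V) x
  map_zero' := rfl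
  map_add' _ _ := rfl

theorem toLeavitt_surjective : Function.Surjective (toLeavitt K V) :=
  Quotient.mk''_surjective

noncomputable instance : Module K (LeavittPathAlgebra K V) :=
  (toLeavitt_surjective K V).module K (toLeavitt K V) fun _ _ => rfl

instance : IsScalarTower K (LeavittPathAlgebra K V) (LeavittPathAlgebra K V) where
  smul_assoc k x y := by
    obtain ⟨x, rfl⟩ := toLeavitt_surjective K V x
    obtain ⟨y, rfl⟩ := toLeavitt_surjective K V y
    exact congrArg (toLeavitt K V) (smul_mul_assoc k x y)

instance : SMulCommClass K (LeavittPathAlgebra K V) (LeavittPathAlgebra K V) where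
  smul_comm k x y := by
    obtain ⟨x, rfl⟩ := toLeavitt_surjective K V x
    obtain ⟨y, rfl⟩ := toLeavitt_surjective K V y
    exact congrArg (toLeavitt K V) (mul_smul_comm k x y).symm

end Leavitt

end LeavittQuiver

/-! Combinatorial part. Let H be the hereditary saturated closure of the line points. Sinks are line
points and H is saturated, so in a row-finite quiver every vertex outside H emits an arrow to a
vertex outside H (`exists_arrow_of_notMem_hsClosure_linePoints`). A path that starts at a line point
of Q ∖ H can therefore always be prolonged inside Q ∖ H, and it never meets itself, because the
first return would close a cycle in the tree of its source. This gives (1) and (2); with finitely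
many vertices no such line point exists, and the series of line points is constant from step 1 on.

Algebraic part. It suffices that L/Soc(L) has no minimal left ideal (`socleOver_eq_self`). The tool
is a right L-module with basis the infinite paths, each with an integer degree: an arrow is removed
from the front and lowers the degree, a ghost arrow is put in front and raises it. Let I act
trivially on this module and contain every vertex from which no infinite path starts. Suppose b is
nonzero mod I and is generated by each of its nonzero multiples. Multiplying b on the right by a
long path clears the ghost arrows; a left multiple and a conjugation along an infinite path then
give q = k·v + (longer paths), k ≠ 0, with a periodic infinite path y starting at v. Such a q acts
injectively on the part of the module at v (`eq_zero_of_act_eq_zero`). Let c be the period of y and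
r = v - c. The degrees show rq ∉ I, so q = trq mod I for some t; cancelling q at y gives y = y·t·r.
But the sum of the coefficients at y over all degrees is 1 on the left and 0 on the right
(`not_isMinimalModulo`).

This is used twice: I the annihilator of the module shows that Soc(L) annihilates it, and then I =
Soc(L) is admissible, since vertices without infinite paths lie in the socle (`vertex_mem_socle`).
-/

namespace LeavittQuiver

universe u v w

/-! ### Arrow sequences and first returns -/

section Sequences

variable {V : Type u} [Quiver.{v} V]

theorem exists_path_of_seq (f : ℕ → V) (n : ℕ) (h : ∀ i < n, Nonempty (f i ⟶ f (i + 1))) :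
    ∃ p : Quiver.Path (f 0) (f n), p.length = n ∧ p.vertices = (List.range (n + 1)).map f := by
  induction n with
  | zero => exact ⟨.nil, rfl, rfl⟩
  | succ n ih =>
    obtain ⟨p, hp, hv⟩ := ih fun i hi => h i (hi.trans n.lt_succ_self)
    obtain ⟨e⟩ := h n n.lt_succ_self
    refine ⟨p.cons e, by simp [hp], ?_⟩
    rw [Quiver.Path.vertices_cons, hv, List.range_succ (n := n + 1)]
    simp

theorem hasCycleAt_of_seq (f : ℕ → V) (n : ℕ) (hn : 0 < n)
    (h : ∀ i < n, Nonempty (f i ⟶ f (i + 1))) (hinj : Set.InjOn f (Set.Iio n))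
    (heq : f n = f 0) : HasCycleAt (f 0) := by
  obtain ⟨p, hp, hv⟩ := exists_path_of_seq f n h
  -- The end point is a variable here so that the equation with `f 0` can be substituted and the
  -- path becomes closed.
  have key : ∀ b (q : Quiver.Path (f 0) b), b = f 0 → q.length = n →
      q.vertices = (List.range (n + 1)).map f → HasCycleAt (f 0) := by
    rintro b q rfl hq hv
    refine ⟨q, hq ▸ hn, ?_⟩
    rw [hv, List.range_succ, List.map_append, List.map_singleton, List.dropLast_concat]
    exact List.Nodup.map_on (fun x hx y hy hxy =>
      hinj (List.mem_range.1 hx) (List.mem_range.1 hy) hxy) List.nodup_range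
  exact key _ p heq hp hv

/-- A sequence of arrows in a quiver that returns for the first time at step `n` to a vertex
visited before produces a cycle at that vertex. -/
theorem hasCycleAt_of_return (f : ℕ → V) (n : ℕ) (h : ∀ i < n, Nonempty (f i ⟶ f (i + 1)))
    (hinj : Set.InjOn f (Set.Iio n)) {i : ℕ} (hi : i < n) (heq : f n = f i) :
    HasCycleAt (f i) := by
  refine hasCycleAt_of_seq (fun j => f (i + j)) (n - i) (by omega) (fun j hj => ?_) ?_ ?_
  · exact h (i + j) (by omega)
  · intro a ha b hb hab
    have := hinj (x₁ := i + a) (x₂ := i + b) (by simp at ha ⊢; omega) (by simp at hb ⊢; omega) hab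
    omega
  · simpa [Nat.add_sub_cancel' hi.le] using heq

theorem IsLinePoint.not_hasCycleAt_of_seq {f : ℕ → V} (hf : IsLinePoint (f 0)) {n : ℕ}
    (h : ∀ i < n, Nonempty (f i ⟶ f (i + 1))) : ¬ HasCycleAt (f n) :=
  let ⟨p, _⟩ := exists_path_of_seq f n h
  (hf _ ⟨p⟩).2

/-- In a finite quiver no infinite path starts at a line point. -/
theorem IsLinePoint.false_of_seq [Finite V] {f : ℕ → V} (hf : IsLinePoint (f 0))
    (h : ∀ i, Nonempty (f i ⟶ f (i + 1))) : False := by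
  classical
  have hex : ∃ n, ∃ i < n, f n = f i := by
    obtain ⟨a, b, hab, heq⟩ := Finite.exists_ne_map_eq_of_infinite f
    rcases lt_or_gt_of_ne hab with hlt | hlt
    · exact ⟨b, a, hlt, heq.symm⟩
    · exact ⟨a, b, hlt, heq⟩
  -- The least repetition time: before it all vertices differ, so the segment from `i` is a cycle.
  obtain ⟨i, hi, heq⟩ := Nat.find_spec hex
  refine hf.not_hasCycleAt_of_seq (n := i) (fun j _ => h j)
    (hasCycleAt_of_return f (Nat.find hex) (fun j _ => h j) ?_ hi heq)
  intro a ha b hb hab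
  by_contra hne
  rcases lt_or_gt_of_ne hne with hlt | hlt
  · exact Nat.find_min hex hb ⟨a, hlt, hab.symm⟩
  · exact Nat.find_min hex ha ⟨b, hlt, hab⟩

theorem exists_seq_of_forall_exists_arrow {S : Set V}
    (hS : ∀ a ∈ S, ∃ b ∈ S, Nonempty (a ⟶ b)) {a : V} (ha : a ∈ S) :
    ∃ f : ℕ → V, f 0 = a ∧ ∀ i, Nonempty (f i ⟶ f (i + 1)) := by
  choose g hg hg' using hS
  let F : ℕ → S := fun n => Nat.rec ⟨a, ha⟩ (fun _ b => ⟨g b.1 b.2, hg b.1 b.2⟩) n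
  exact ⟨fun n => (F n).1, rfl, fun i => hg' (F i).1 (F i).2⟩

end Sequences

/-! ### Vertices outside the closure of the line points -/

section LinePoints

variable {V : Type u} [Quiver.{v} V]

theorem subset_hsClosure (S : Set V) : S ⊆ hsClosure S :=
  fun _ ha _ hH => hH.1 ha

theorem isSaturated_hsClosure (S : Set V) : IsSaturated (hsClosure S) :=
  fun a ha h H hH => hH.2.2 a ha fun b e => h b e H hH

/-- A vertex that emits no arrows is a line point. -/
theorem isLinePoint_of_isEmpty {a : V} (h : IsEmpty (Quiver.Star a)) : IsLinePoint a := by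
  have hpath : ∀ b, Quiver.Path a b → a = b := by
    intro b p
    induction p with
    | nil => rfl
    | cons p e ih => subst ih; exact h.elim ⟨_, e⟩
  rintro b ⟨p⟩
  obtain rfl := hpath b p
  refine ⟨fun hb => ?_, ?_⟩
  · obtain ⟨x, -⟩ := hb.exists_pair_ne
    exact h.elim x
  · rintro ⟨q, hq, -⟩
    cases q with
    | nil => simp at hq
    | cons q e => obtain rfl := hpath _ q; exact h.elim ⟨_, e⟩

/-- In a row-finite quiver a vertex outside a saturated set that contains all sinks emits an
arrow to another such vertex. -/
theorem IsSaturated.exists_arrow (hrow : RowFinite V) {G : Set V} (hG : IsSaturated G)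
    (hsink : ∀ a : V, IsEmpty (Quiver.Star a) → a ∈ G) {a : V} (ha : a ∉ G) :
    ∃ b ∉ G, Nonempty (a ⟶ b) := by
  by_contra! h
  refine ha (hG a ⟨?_, hrow a⟩ fun b e => ?_)
  · by_contra hs
    exact ha (hsink a (not_nonempty_iff.1 hs))
  · by_contra hb
    exact (h b hb).elim e

/-- Sinks are line points, hence in the closure; so the quiver outside the closure has no sinks. -/
theorem exists_arrow_of_notMem_hsClosure_linePoints (hrow : RowFinite V) {a : V}
    (ha : a ∉ hsClosure (linePoints V)) : ∃ b ∉ hsClosure (linePoints V), Nonempty (a ⟶ b) :=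
  (isSaturated_hsClosure _).exists_arrow hrow
    (fun _ h => subset_hsClosure _ (isLinePoint_of_isEmpty h)) ha

/-- If the next vertex `w` were some `u i`, the segment from `u i` to `w` would be a cycle in the
tree of the line point `u 0`. -/
theorem exists_arrow_notMem_range (hrow : RowFinite V) (k : ℕ) (u : Fin (k + 1) → V)
    (hinj : Function.Injective u) (hu : ∀ i, u i ∉ hsClosure (linePoints V))
    (harr : ∀ i : Fin k, Nonempty (u i.castSucc ⟶ u i.succ))
    (h0 : u 0 ∈ linePointsOff (hsClosure (linePoints V))) :
    ∃ w : V, w ∉ Set.range u ∧ w ∉ hsClosure (linePoints V) ∧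
      Nonempty (u (Fin.last k) ⟶ w) := by
  obtain ⟨w, hw, e⟩ := exists_arrow_of_notMem_hsClosure_linePoints hrow (hu (Fin.last k))
  refine ⟨w, ?_, hw, e⟩
  rintro ⟨i, hi⟩
  obtain ⟨a, ha, ha0⟩ := h0
  -- The sequence `u 0, …, u k, w`; the constant value after index `k + 1` plays no role.
  let f : ℕ → Remove (hsClosure (linePoints V)) := fun j =>
    if h : j < k + 1 then ⟨u ⟨j, h⟩, hu _⟩ else ⟨w, hw⟩
  have hf : ∀ j (h : j < k + 1), f j = ⟨u ⟨j, h⟩, hu _⟩ := fun j h => dif_pos h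
  have hfk : f (k + 1) = ⟨w, hw⟩ := dif_neg (lt_irrefl _)
  have hf0 : f 0 = a := by
    rw [hf 0 k.succ_pos]
    exact Subtype.ext ha0.symm
  have harr' : ∀ j < k + 1, Nonempty (f j ⟶ f (j + 1)) := by
    intro j hj
    rcases Nat.lt_succ_iff_lt_or_eq.1 hj with hjk | rfl
    · rw [hf j hj, hf (j + 1) (by omega)]
      exact harr ⟨j, hjk⟩
    · rw [hf j hj, hfk]
      exact e
  have hcyc := hasCycleAt_of_return f (k + 1) harr' ?_ i.2 (by
    rw [hfk, hf _ i.2]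
    exact Subtype.ext hi.symm)
  · exact IsLinePoint.not_hasCycleAt_of_seq (f := f) (by rw [hf0]; exact ha)
      (fun j hj => harr' j (by omega)) hcyc
  · intro x hx y hy hxy
    rw [hf x hx, hf y hy] at hxy
    exact congrArg Fin.val (hinj (congrArg Subtype.val hxy))

theorem linePointsOff_hsClosure_linePoints_eq_empty [Finite V] (hrow : RowFinite V) :
    linePointsOff (hsClosure (linePoints V)) = ∅ := by
  rw [Set.eq_empty_iff_forall_notMem]
  rintro _ ⟨a, ha, rfl⟩
  have : Finite (Remove (hsClosure (linePoints V))) := Subtype.finite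
  obtain ⟨f, rfl, hf⟩ := exists_seq_of_forall_exists_arrow
    (S := (Set.univ : Set (Remove (hsClosure (linePoints V))))) (fun b _ => by
      obtain ⟨c, hc, e⟩ := exists_arrow_of_notMem_hsClosure_linePoints hrow b.2
      exact ⟨⟨c, hc⟩, trivial, e⟩) (Set.mem_univ a)
  exact IsLinePoint.false_of_seq ha hf

end LinePoints

/-! ### Stationary series and minimal left ideals -/

section Series

theorem linePointSeries_zero (V : Type u) [Quiver.{v} V] : linePointSeries V 0 = ∅ := by
  simp [linePointSeries]

theorem linePointSeries_add_one (V : Type u) [Quiver.{v} V] {α : Ordinal.{u}} (hα : α ≠ 0) :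
    linePointSeries V (α + 1) =
      linePointSeries V α ∪ linePointsOff (hsClosure (linePointSeries V α)) := by
  simp [linePointSeries, hα]

theorem linePointSeries_one (V : Type u) [Quiver.{v} V] :
    linePointSeries V 1 = linePoints V := by
  rw [← zero_add (1 : Ordinal)]
  simp only [linePointSeries, Ordinal.limitRecOn_add_one, if_true]

/-- The inclusion is carried along because the unions at limits include the index 0, where the value
is the empty set. -/
theorem linePointSeries_le_one (V : Type u) [Quiver.{v} V]
    (h : linePointsOff (hsClosure (linePoints V)) = ∅) (α : Ordinal.{u}) :
    linePointSeries V α ⊆ linePoints V ∧ (α ≠ 0 → linePointSeries V α = linePoints V) := by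
  induction α using Ordinal.limitRecOn with
  | zero => simp [linePointSeries_zero]
  | add_one α ih =>
    have : linePointSeries V (α + 1) = linePoints V := by
      by_cases hα : α = 0
      · rw [hα, zero_add, linePointSeries_one]
      · rw [linePointSeries_add_one V hα, ih.2 hα, h, Set.union_empty]
    exact ⟨this.le, fun _ => this⟩
  | limit β hβ ih =>
    have hs : linePointSeries V β = ⋃ (α : Ordinal.{u}) (_ : α < β), linePointSeries V α := by
      rw [linePointSeries, Ordinal.limitRecOn_limit _ _ _ _ hβ]; rfl
    have hle : linePointSeries V β ⊆ linePoints V := by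
      rw [hs]
      exact Set.iUnion₂_subset fun α hα => (ih α hα).1
    refine ⟨hle, fun _ => hle.antisymm ?_⟩
    rw [hs, ← linePointSeries_one]
    exact Set.subset_iUnion₂_of_subset 1 (Ordinal.one_lt_of_isSuccLimit hβ) le_rfl

theorem linePointUnion_eq_series_one (V : Type u) [Quiver.{v} V]
    (h : linePointsOff (hsClosure (linePoints V)) = ∅) :
    linePointUnion V = linePointSeries V 1 := by
  refine (Set.iUnion_subset fun α => ?_).antisymm (Set.subset_iUnion _ 1)
  rw [linePointSeries_one]
  exact (linePointSeries_le_one V h α).1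

variable (A : Type w) [NonUnitalRing A]

theorem socleSeries_one : socleSeries A 1 = socle A := by
  rw [← zero_add (1 : Ordinal)]
  simp only [socleSeries, Ordinal.limitRecOn_add_one, if_true]

theorem socleSeries_add_one {α : Ordinal.{w}} (hα : α ≠ 0) :
    socleSeries A (α + 1) = socleOver (socleSeries A α) := by
  simp [socleSeries, hα]

theorem socleSeries_le_one (h : socleOver (socle A) = socle A) (α : Ordinal.{w}) :
    socleSeries A α ≤ socle A ∧ (α ≠ 0 → socleSeries A α = socle A) := by
  induction α using Ordinal.limitRecOn with
  | zero => simp [socleSeries]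
  | add_one α ih =>
    have : socleSeries A (α + 1) = socle A := by
      by_cases hα : α = 0
      · rw [hα, zero_add, socleSeries_one]
      · rw [socleSeries_add_one A hα, ih.2 hα, h]
    exact ⟨this.le, fun _ => this⟩
  | limit β hβ ih =>
    have hs : socleSeries A β = ⨆ (α : Ordinal.{w}) (_ : α < β), socleSeries A α := by
      rw [socleSeries, Ordinal.limitRecOn_limit _ _ _ _ hβ]; rfl
    have hle : socleSeries A β ≤ socle A := by
      rw [hs]
      exact iSup₂_le fun α hα => (ih α hα).1
    refine ⟨hle, fun _ => hle.antisymm ?_⟩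
    rw [hs, ← socleSeries_one]
    exact le_iSup₂_of_le 1 (Ordinal.one_lt_of_isSuccLimit hβ) le_rfl

theorem socleSeries_two_eq_one (h : socleOver (socle A) = socle A) :
    socleSeries A 2 = socleSeries A 1 := by
  rw [← one_add_one_eq_two, socleSeries_add_one A one_ne_zero, socleSeries_one, h]

theorem socleSum_eq_series_one (h : socleOver (socle A) = socle A) :
    socleSum A = socleSeries A 1 := by
  refine (iSup_le fun α => ?_).antisymm (le_iSup (socleSeries A) 1)
  rw [socleSeries_one]
  exact (socleSeries_le_one A h α).1

theorem mem_socle {x : A} : x ∈ socle A ↔ x ∈ socleAddSubgroup A :=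
  TwoSidedIdeal.mem_mk' ..

variable {A}

theorem quotientMap_eq_zero_iff {I : TwoSidedIdeal A} {x : A} : quotientMap I x = 0 ↔ x ∈ I :=
  RingCon.eq _

theorem quotientMap_surjective (I : TwoSidedIdeal A) : Function.Surjective (quotientMap I) :=
  Quotient.mk''_surjective

theorem socleOver_eq_self {I : TwoSidedIdeal A}
    (h : ∀ M : AddSubgroup I.ringCon.Quotient, ¬ IsMinimalLeftIdeal M) : socleOver I = I := by
  ext x
  rw [socleOver, TwoSidedIdeal.mem_comap, mem_socle, ← quotientMap_eq_zero_iff]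
  have : socleAddSubgroup I.ringCon.Quotient = ⊥ := by
    rw [socleAddSubgroup, Set.eq_empty_of_forall_notMem (s := {M | IsMinimalLeftIdeal M}) h,
      sSup_empty]
  rw [this, AddSubgroup.mem_bot]

/-- In a ring with a left unit, a nonzero multiple of an element of a minimal left ideal generates
that ideal. -/
theorem IsMinimalLeftIdeal.exists_mul_mul_eq {M : AddSubgroup A} (hM : IsMinimalLeftIdeal M)
    {one : A} (hone : ∀ a, one * a = a) {b r : A} (hb : b ∈ M) (hr : r * b ≠ 0) :
    ∃ y, y * (r * b) = b := by
  have hle : M ≤ (AddMonoidHom.mulRight (r * b)).range := by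
    refine hM.2 ⟨?_, ?_⟩ ?_
    · rintro a _ ⟨y, rfl⟩
      exact ⟨a * y, by simp [mul_assoc]⟩
    · intro hbot
      refine hr ?_
      rw [← AddSubgroup.mem_bot, ← hbot]
      exact ⟨one, hone _⟩
    · rintro _ ⟨y, rfl⟩
      exact hM.1.1 _ _ (hM.1.1 _ _ hb)
  exact hle hb

end Series

/-! ### Calculus of generators in the Leavitt path algebra -/

section LeavittElements

variable (K : Type w) [Field K] {V : Type u} [Quiver.{v} V]

/-- The vertex `a` in the Leavitt path algebra. -/
noncomputable def vertex (a : V) : LeavittPathAlgebra K V := toLeavitt K V (fVertex K a)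

/-- The arrow `e` in the Leavitt path algebra. -/
noncomputable def arrow (e : Quiver.Total V) : LeavittPathAlgebra K V :=
  toLeavitt K V (fArrow K e)

/-- The ghost arrow `e*` in the Leavitt path algebra. -/
noncomputable def ghost (e : Quiver.Total V) : LeavittPathAlgebra K V :=
  toLeavitt K V (fGhost K e)

theorem toLeavitt_mul (x y : FreeAlg K V) :
    toLeavitt K V (x * y) = toLeavitt K V x * toLeavitt K V y := rfl

theorem toLeavitt_smul (k : K) (x : FreeAlg K V) :
    toLeavitt K V (k • x) = k • toLeavitt K V x := rfl

variable {K} in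
theorem toLeavitt_eq_of_rel {x y : FreeAlg K V} (h : Rel K V x y) :
    toLeavitt K V x = toLeavitt K V y :=
  (RingCon.eq _).2 (RingConGen.Rel.of _ _ ⟨1, x, y, h, (one_smul _ _).symm, (one_smul _ _).symm⟩)

theorem vertex_mul_self (a : V) : vertex K a * vertex K a = vertex K a :=
  toLeavitt_eq_of_rel (.vertex_mul_self a)

theorem vertex_mul_ne {a b : V} (h : a ≠ b) : vertex K a * vertex K b = 0 :=
  toLeavitt_eq_of_rel (.vertex_mul_ne a b h)

theorem source_mul_arrow (e : Quiver.Total V) : vertex K e.left * arrow K e = arrow K e :=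
  toLeavitt_eq_of_rel (.source_arrow e)

theorem arrow_mul_range (e : Quiver.Total V) : arrow K e * vertex K e.right = arrow K e :=
  toLeavitt_eq_of_rel (.arrow_range e)

theorem range_mul_ghost (e : Quiver.Total V) : vertex K e.right * ghost K e = ghost K e :=
  toLeavitt_eq_of_rel (.range_ghost e)

theorem ghost_mul_source (e : Quiver.Total V) : ghost K e * vertex K e.left = ghost K e :=
  toLeavitt_eq_of_rel (.ghost_source e)

theorem ghost_mul_arrow_self (e : Quiver.Total V) :
    ghost K e * arrow K e = vertex K e.right :=
  toLeavitt_eq_of_rel (.ck1_self e)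

theorem ghost_mul_arrow_ne {e f : Quiver.Total V} (h : e ≠ f) : ghost K e * arrow K f = 0 :=
  toLeavitt_eq_of_rel (.ck1_ne e f h)

theorem vertex_eq_sum (a : V) (h : Nonempty (Quiver.Star a)) [Fintype (Quiver.Star a)] :
    vertex K a = ∑ p : Quiver.Star a, arrow K (starArrow p) * ghost K (starArrow p) := by
  rw [vertex, toLeavitt_eq_of_rel (.ck2 a h inferInstance), map_sum]
  rfl

theorem vertex_mul_arrow_ne {a : V} {e : Quiver.Total V} (h : a ≠ e.left) :
    vertex K a * arrow K e = 0 := by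
  rw [← source_mul_arrow, ← mul_assoc, vertex_mul_ne K h, zero_mul]

theorem vertex_mul_ghost_ne {a : V} {e : Quiver.Total V} (h : a ≠ e.right) :
    vertex K a * ghost K e = 0 := by
  rw [← range_mul_ghost, ← mul_assoc, vertex_mul_ne K h, zero_mul]

theorem arrow_mul_vertex_ne {a : V} {e : Quiver.Total V} (h : e.right ≠ a) :
    arrow K e * vertex K a = 0 := by
  rw [← arrow_mul_range, mul_assoc, vertex_mul_ne K h, mul_zero]

theorem ghost_mul_vertex_ne {a : V} {e : Quiver.Total V} (h : e.left ≠ a) :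
    ghost K e * vertex K a = 0 := by
  rw [← ghost_mul_source, mul_assoc, vertex_mul_ne K h, mul_zero]

variable {K}

/-- Induction principle for the Leavitt path algebra: it is spanned by the products of
generators. -/
theorem leavitt_induction {P : LeavittPathAlgebra K V → Prop} (x : LeavittPathAlgebra K V)
    (hvertex : ∀ a, P (vertex K a)) (harrow : ∀ e, P (arrow K e)) (hghost : ∀ e, P (ghost K e))
    (hzero : P 0) (hadd : ∀ x y, P x → P y → P (x + y))
    (hmul : ∀ x y, P x → P y → P (x * y)) (hsmul : ∀ (k : K) x, P x → P (k • x)) : P x := by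
  obtain ⟨x, rfl⟩ := toLeavitt_surjective K V x
  have hword : ∀ s : FreeSemigroup (Gen V), P (toLeavitt K V (MonoidAlgebra.single s 1)) := by
    have hof : ∀ g : Gen V, P (toLeavitt K V (MonoidAlgebra.single (FreeSemigroup.of g) 1)) := by
      rintro (a | e | e)
      · exact hvertex a
      · exact harrow e
      · exact hghost e
    intro s
    induction s using FreeSemigroup.recOnMul with
    | ih1 g => exact hof g
    | ih2 g s _ ih =>
      have : MonoidAlgebra.single (FreeSemigroup.of g * s) (1 : K) =
          MonoidAlgebra.single (FreeSemigroup.of g) 1 * MonoidAlgebra.single s 1 := by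
        rw [MonoidAlgebra.single_mul_single, one_mul]
      rw [this, toLeavitt_mul]
      exact hmul _ _ (hof g) ih
  induction x using MonoidAlgebra.induction_linear with
  | zero => simpa using hzero
  | add x y hx hy => rw [map_add]; exact hadd _ _ hx hy
  | single s k =>
    have : MonoidAlgebra.single s k = k • MonoidAlgebra.single s (1 : K) := by simp
    rw [this, toLeavitt_smul]
    exact hsmul _ _ (hword s)

variable (K V) in
/-- The sum of all vertices: the unit of the Leavitt path algebra of a quiver with finitely many
vertices. -/
noncomputable def vertexSum [Fintype V] : LeavittPathAlgebra K V := ∑ a : V, vertex K a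

theorem vertexSum_mul_and_mul_vertexSum [Fintype V] (x : LeavittPathAlgebra K V) :
    vertexSum K V * x = x ∧ x * vertexSum K V = x := by
  induction x using leavitt_induction with
  | hvertex a =>
    rw [vertexSum, Finset.sum_mul, Finset.mul_sum]
    exact ⟨(Finset.sum_eq_single a (fun b _ h => vertex_mul_ne K h) (by simp)).trans
      (vertex_mul_self K a), (Finset.sum_eq_single a (fun b _ h => vertex_mul_ne K h.symm)
      (by simp)).trans (vertex_mul_self K a)⟩
  | harrow e =>
    rw [vertexSum, Finset.sum_mul, Finset.mul_sum]
    exact ⟨(Finset.sum_eq_single e.left (fun b _ h => vertex_mul_arrow_ne K h) (by simp)).trans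
      (source_mul_arrow K e), (Finset.sum_eq_single e.right
      (fun b _ h => arrow_mul_vertex_ne K h.symm) (by simp)).trans (arrow_mul_range K e)⟩
  | hghost e =>
    rw [vertexSum, Finset.sum_mul, Finset.mul_sum]
    exact ⟨(Finset.sum_eq_single e.right (fun b _ h => vertex_mul_ghost_ne K h) (by simp)).trans
      (range_mul_ghost K e), (Finset.sum_eq_single e.left
      (fun b _ h => ghost_mul_vertex_ne K h.symm) (by simp)).trans (ghost_mul_source K e)⟩
  | hzero => simp
  | hadd x y hx hy => rw [mul_add, add_mul, hx.1, hy.1, hx.2, hy.2]; exact ⟨rfl, rfl⟩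
  | hmul x y hx hy => rw [← mul_assoc, hx.1, mul_assoc, hy.2]; exact ⟨rfl, rfl⟩
  | hsmul k x hx => rw [mul_smul_comm, smul_mul_assoc, hx.1, hx.2]; exact ⟨rfl, rfl⟩

theorem vertexSum_mul [Fintype V] (x : LeavittPathAlgebra K V) : vertexSum K V * x = x :=
  (vertexSum_mul_and_mul_vertexSum x).1

theorem mul_vertexSum [Fintype V] (x : LeavittPathAlgebra K V) : x * vertexSum K V = x :=
  (vertexSum_mul_and_mul_vertexSum x).2

/-- Left ideals are only additive subgroups here; the unit makes them subspaces, as k • x = (k • 1)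
x. -/
theorem IsLeftIdeal.smul_mem [Finite V] {M : AddSubgroup (LeavittPathAlgebra K V)}
    (hM : IsLeftIdeal M) (k : K) {x : LeavittPathAlgebra K V} (hx : x ∈ M) : k • x ∈ M := by
  have := Fintype.ofFinite V
  rw [← vertexSum_mul x, ← smul_mul_assoc]
  exact hM _ _ hx

end LeavittElements

/-! ### The graded right module on infinite paths -/

section PathModule

variable (V : Type u) [Quiver.{v} V]

/-- The infinite paths in a quiver. -/
def InfPath : Type (max u v) :=
  {x : ℕ → Quiver.Total V // ∀ n, (x n).right = (x (n + 1)).left}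

variable {V}

/-- The first arrow of an infinite path. -/
def InfPath.head (x : InfPath V) : Quiver.Total V := x.1 0

/-- An infinite path without its first arrow. -/
def InfPath.tail (x : InfPath V) : InfPath V := ⟨fun n => x.1 (n + 1), fun n => x.2 (n + 1)⟩

/-- The infinite path that consists of an arrow and an infinite path. -/
def InfPath.cons (e : Quiver.Total V) (x : InfPath V) (h : e.right = x.head.left) : InfPath V :=
  ⟨fun n => Nat.casesOn n e x.1, fun n => by cases n; exacts [h, x.2 _]⟩

@[simp] theorem InfPath.head_cons (e : Quiver.Total V) (x : InfPath V) (h) :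
    (InfPath.cons e x h).head = e := rfl

@[simp] theorem InfPath.tail_cons (e : Quiver.Total V) (x : InfPath V) (h) :
    (InfPath.cons e x h).tail = x := rfl

theorem InfPath.right_head (x : InfPath V) : x.head.right = x.tail.head.left := x.2 0

theorem InfPath.cons_head_tail (x : InfPath V) :
    InfPath.cons x.head x.tail x.right_head = x := by
  apply Subtype.ext
  funext n
  cases n <;> rfl

theorem InfPath.ext_head_tail {x y : InfPath V} (h : x.head = y.head) (h' : x.tail = y.tail) :
    x = y := by
  apply Subtype.ext
  funext n
  cases n with
  | zero => exact h
  | succ n => exact congrFun (congrArg Subtype.val h') n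

theorem starArrow_injective {a : V} : Function.Injective (starArrow (a := a)) := by
  rintro ⟨b, e⟩ ⟨c, f⟩ h
  cases h
  rfl

variable (K : Type w) [Field K]

variable (V) in
/-- The `K`-space spanned by pairs of an infinite path and an integer degree. -/
abbrev PathModule : Type (max u v w) := (InfPath V × ℤ) →₀ K

variable {K}

open Classical in
/-- The right action of the generators on the basis of the path module: vertices act as
projections, an arrow is removed from the front, a ghost arrow is put in front. -/
noncomputable def genActBasis : Gen V → InfPath V × ℤ → PathModule V K
  | .vertex a, x => if x.1.head.left = a then .single x 1 else 0
  | .arrow e, x => if x.1.head = e then .single (x.1.tail, x.2 - 1) 1 else 0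
  | .ghost e, x => if h : e.right = x.1.head.left then .single (x.1.cons e h, x.2 + 1) 1 else 0

/-- The right action of the generators on the path module. -/
noncomputable def genAct (g : Gen V) : Module.End K (PathModule V K) :=
  Finsupp.linearCombination K (genActBasis g)

theorem genAct_single (g : Gen V) (x : InfPath V × ℤ) (k : K) :
    genAct g (Finsupp.single x k) = k • genActBasis g x := by
  simp [genAct]

/-- The right action of the free algebra on the path module. -/
noncomputable def freeAct : FreeAlg K V →ₙₐ[K] (Module.End K (PathModule V K))ᵐᵒᵖ :=
  MonoidAlgebra.liftMagma K (FreeSemigroup.lift fun g => MulOpposite.op (genAct g))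

theorem freeAct_of (g : Gen V) :
    freeAct (MonoidAlgebra.single (FreeSemigroup.of g) (1 : K)) = .op (genAct g) := by
  simp [freeAct]

theorem freeAct_fVertex (a : V) : freeAct (fVertex K a) = .op (genAct (.vertex a)) :=
  freeAct_of _

theorem freeAct_fArrow (e : Quiver.Total V) : freeAct (fArrow K e) = .op (genAct (.arrow e)) :=
  freeAct_of _

theorem freeAct_fGhost (e : Quiver.Total V) : freeAct (fGhost K e) = .op (genAct (.ghost e)) :=
  freeAct_of _

/-- The first Cuntz–Krieger relation says that an arrow put in front is the only one that can be
removed again; the second, that an infinite path has exactly one first arrow. -/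
theorem freeAct_eq_of_rel {x y : FreeAlg K V} (h : Rel K V x y) : freeAct x = freeAct y := by
  apply MulOpposite.unop_injective
  refine Finsupp.lhom_ext' fun ⟨x, n⟩ => LinearMap.ext_ring ?_
  cases h with
  | vertex_mul_self a =>
    by_cases h : x.head.left = a <;>
      simp [freeAct_fVertex, genAct_single, genActBasis, h]
  | vertex_mul_ne a b hab =>
    by_cases h : x.head.left = a
    · subst h
      simp [freeAct_fVertex, genAct_single, genActBasis, hab]
    · simp [freeAct_fVertex, genAct_single, genActBasis, h]
  | source_arrow e =>
    by_cases h : x.head = e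
    · subst h
      simp [freeAct_fVertex, freeAct_fArrow, genAct_single, genActBasis]
    · by_cases h' : x.head.left = e.left <;>
        simp [freeAct_fVertex, freeAct_fArrow, genAct_single, genActBasis, h, h']
  | arrow_range e =>
    by_cases h : x.head = e
    · subst h
      simp [freeAct_fVertex, freeAct_fArrow, genAct_single, genActBasis, x.right_head]
    · simp [freeAct_fVertex, freeAct_fArrow, genAct_single, genActBasis, h]
  | range_ghost e =>
    by_cases h : e.right = x.head.left
    · simp [freeAct_fVertex, freeAct_fGhost, genAct_single, genActBasis, h]
    · simp [freeAct_fVertex, freeAct_fGhost, genAct_single, genActBasis, h, Ne.symm h]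
  | ghost_source e =>
    by_cases h : e.right = x.head.left <;>
      simp [freeAct_fVertex, freeAct_fGhost, genAct_single, genActBasis, h]
  | ck1_self e =>
    by_cases h : e.right = x.head.left
    · simp [freeAct_fVertex, freeAct_fGhost, freeAct_fArrow, genAct_single, genActBasis, h]
    · simp [freeAct_fVertex, freeAct_fGhost, freeAct_fArrow, genAct_single, genActBasis, h,
        Ne.symm h]
  | ck1_ne e f hef =>
    by_cases h : e.right = x.head.left <;>
      simp [freeAct_fGhost, freeAct_fArrow, genAct_single, genActBasis, h, hef]
  | ck2 a hne hfin =>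
    classical
    -- Each `e e*` acts as the projection onto the paths with first arrow `e`.
    have key : ∀ e : Quiver.Total V,
        (freeAct (fArrow K e * fGhost K e)).unop (Finsupp.single (x, n) 1) =
          if x.head = e then Finsupp.single (x, n) 1 else 0 := by
      intro e
      by_cases h : x.head = e
      · subst h
        simp [freeAct_fGhost, freeAct_fArrow, genAct_single, genActBasis, x.right_head,
          InfPath.cons_head_tail]
      · simp [freeAct_fGhost, freeAct_fArrow, genAct_single, genActBasis, h]
    simp only [map_sum, Finset.unop_sum, LinearMap.coe_comp, Function.comp_apply,
      Finsupp.lsingle_apply, LinearMap.sum_apply, key]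
    by_cases h : x.head.left = a
    · subst h
      rw [Finset.sum_eq_single (⟨x.head.right, x.head.hom⟩ : Quiver.Star x.head.left)]
      · simp [freeAct_fVertex, genAct_single, genActBasis, starArrow]
      · rintro p - hp
        refine if_neg fun hx => hp ?_
        exact starArrow_injective hx.symm
      · simp
    · rw [Finset.sum_eq_zero]
      · simp [freeAct_fVertex, genAct_single, genActBasis, h]
      · intro p _
        refine if_neg fun hx => h ?_
        rw [hx]
        rfl

variable (V K) in
/-- The right action of the Leavitt path algebra on the path module. -/
noncomputable def pathAct :
    LeavittPathAlgebra K V →ₙ+* (Module.End K (PathModule V K))ᵐᵒᵖ where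
  toFun := Quotient.lift (fun x : FreeAlg K V => freeAct x) (by
    intro x y h
    change RingConGen.Rel (ScaledRel K V) x y at h
    induction h with
    | of x y h =>
      obtain ⟨l, x', y', h, rfl, rfl⟩ := h
      simp only [map_smul, freeAct_eq_of_rel h]
    | refl x => rfl
    | symm _ ih => exact ih.symm
    | trans _ _ ih ih' => exact ih.trans ih'
    | add _ _ ih ih' => simp only [map_add] at ih ih' ⊢; rw [ih, ih']
    | mul _ _ ih ih' => simp only [map_mul] at ih ih' ⊢; rw [ih, ih'])
  map_mul' x y := by
    obtain ⟨x, rfl⟩ := toLeavitt_surjective K V x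
    obtain ⟨y, rfl⟩ := toLeavitt_surjective K V y
    exact map_mul freeAct x y
  map_zero' := map_zero freeAct
  map_add' x y := by
    obtain ⟨x, rfl⟩ := toLeavitt_surjective K V x
    obtain ⟨y, rfl⟩ := toLeavitt_surjective K V y
    exact map_add freeAct x y

/-- The right action of an element of the Leavitt path algebra on the path module. -/
noncomputable def act (a : LeavittPathAlgebra K V) : Module.End K (PathModule V K) :=
  (pathAct V K a).unop

theorem act_mul (a b : LeavittPathAlgebra K V) (f : PathModule V K) :
    act (a * b) f = act b (act a f) := by
  simp [act]

theorem act_add (a b : LeavittPathAlgebra K V) : act (a + b) = act a + act b := by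
  simp [act]

theorem act_sub (a b : LeavittPathAlgebra K V) : act (a - b) = act a - act b := by
  simp [act]

@[simp] theorem act_zero : act (0 : LeavittPathAlgebra K V) = 0 := by
  simp [act]

theorem act_smul (k : K) (a : LeavittPathAlgebra K V) : act (k • a) = k • act a := by
  obtain ⟨a, rfl⟩ := toLeavitt_surjective K V a
  exact congrArg MulOpposite.unop (map_smul freeAct k a)

theorem act_vertex (a : V) : act (vertex K a) = genAct (.vertex a) :=
  congrArg MulOpposite.unop (freeAct_fVertex a)

theorem act_arrow (e : Quiver.Total V) : act (arrow K e) = genAct (.arrow e) :=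
  congrArg MulOpposite.unop (freeAct_fArrow e)

theorem mem_ker_pathAct {a : LeavittPathAlgebra K V} :
    a ∈ TwoSidedIdeal.ker (pathAct V K) ↔ act a = 0 := by
  rw [TwoSidedIdeal.mem_ker, act, MulOpposite.unop_eq_zero_iff]

theorem act_vertex_single (x : InfPath V) (n : ℤ) (k : K) :
    act (vertex K x.head.left) (Finsupp.single (x, n) k) = Finsupp.single (x, n) k := by
  simp [act_vertex, genAct_single, genActBasis]

theorem act_arrow_head_single (x : InfPath V) (n : ℤ) (k : K) :
    act (arrow K x.head) (Finsupp.single (x, n) k) = Finsupp.single (x.tail, n - 1) k := by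
  simp [act_arrow, genAct_single, genActBasis]

theorem act_vertex_eq_zero {a : V} (h : ∀ x : InfPath V, x.head.left ≠ a) :
    act (vertex K a) = 0 := by
  rw [act_vertex]
  refine Finsupp.lhom_ext fun ⟨x, n⟩ k => ?_
  simp [genAct_single, genActBasis, h x]

variable (K) in
/-- The functional that sums the coefficients at a given infinite path over all degrees. -/
noncomputable def coeffSum (x : InfPath V) : PathModule V K →ₗ[K] K := by
  classical
  exact Finsupp.linearCombination K fun y => if y.1 = x then 1 else 0

theorem coeffSum_single (x : InfPath V) (n : ℤ) (k : K) :
    coeffSum K x (Finsupp.single (x, n) k) = k := by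
  simp [coeffSum]

theorem coeffSum_act_vertex (x : InfPath V) (f : PathModule V K) :
    coeffSum K x (act (vertex K x.head.left) f) = coeffSum K x f := by
  suffices coeffSum K x ∘ₗ act (vertex K x.head.left) = coeffSum K x from
    LinearMap.congr_fun this f
  refine Finsupp.lhom_ext fun ⟨y, n⟩ k => ?_
  by_cases h : y = x
  · subst h
    simp [act_vertex_single]
  · by_cases h' : y.head.left = x.head.left <;>
      simp [act_vertex, genAct_single, genActBasis, h, h', coeffSum]

/-- Head and tail determine a path, so `x` is the only path that this arrow sends to `x.tail`. -/
theorem coeffSum_tail_act_arrow_head (x : InfPath V) (f : PathModule V K) :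
    coeffSum K x.tail (act (arrow K x.head) f) = coeffSum K x f := by
  suffices coeffSum K x.tail ∘ₗ act (arrow K x.head) = coeffSum K x from
    LinearMap.congr_fun this f
  refine Finsupp.lhom_ext fun ⟨y, n⟩ k => ?_
  by_cases h : y = x
  · subst h
    simp [act_arrow_head_single, coeffSum_single]
  · by_cases h' : y.head = x.head
    · have : y.tail ≠ x.tail := fun h'' => h (InfPath.ext_head_tail h' h'')
      simp [act_arrow, genAct_single, genActBasis, h, h', coeffSum, this]
    · simp [act_arrow, genAct_single, genActBasis, h, h', coeffSum]

variable (V K) in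
/-- The subspace of the path module spanned by the elements of degree less than `n`. -/
def degreeLT (n : ℤ) : Submodule K (PathModule V K) := Finsupp.supported K K {x | x.2 < n}

theorem single_mem_degreeLT {x : InfPath V} {m n : ℤ} (h : m < n) (k : K) :
    (Finsupp.single (x, m) k : PathModule V K) ∈ degreeLT V K n :=
  Finsupp.single_mem_supported K k h

theorem degreeLT_mono {m n : ℤ} (h : m ≤ n) : degreeLT V K m ≤ degreeLT V K n :=
  Finsupp.supported_mono fun _ hx => lt_of_lt_of_le hx h

theorem exists_mem_degreeLT (f : PathModule V K) : ∃ n : ℕ, f ∈ degreeLT V K n := by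
  obtain ⟨b, hb⟩ := (f.support.image Prod.snd).bddAbove
  refine ⟨(b + 1).toNat, fun x hx => ?_⟩
  have := hb (Finset.mem_coe.2 (Finset.mem_image_of_mem Prod.snd hx))
  rw [Set.mem_ofPred_eq]
  omega

theorem eq_zero_of_forall_mem_degreeLT {f : PathModule V K} (h : ∀ n, f ∈ degreeLT V K n) :
    f = 0 := by
  by_contra hf
  obtain ⟨x, hx⟩ := Finsupp.support_nonempty_iff.2 hf
  exact lt_irrefl x.2 (h x.2 hx)

theorem act_vertex_mem_degreeLT (a : V) {n : ℤ} {f : PathModule V K}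
    (hf : f ∈ degreeLT V K n) : act (vertex K a) f ∈ degreeLT V K n := by
  rw [degreeLT, Finsupp.supported_eq_span_single] at hf
  induction hf using Submodule.span_induction with
  | zero => simp
  | add _ _ _ _ h h' => rw [map_add]; exact add_mem h h'
  | smul k _ _ h => rw [map_smul]; exact Submodule.smul_mem _ _ h
  | mem f hf =>
    obtain ⟨⟨x, m⟩, hm, rfl⟩ := hf
    rw [act_vertex, genAct_single, one_smul, genActBasis]
    split_ifs
    exacts [single_mem_degreeLT hm _, zero_mem _]

theorem act_arrow_mem_degreeLT (e : Quiver.Total V) {n : ℤ} {f : PathModule V K}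
    (hf : f ∈ degreeLT V K n) : act (arrow K e) f ∈ degreeLT V K (n - 1) := by
  rw [degreeLT, Finsupp.supported_eq_span_single] at hf
  induction hf using Submodule.span_induction with
  | zero => simp
  | add _ _ _ _ h h' => rw [map_add]; exact add_mem h h'
  | smul k _ _ h => rw [map_smul]; exact Submodule.smul_mem _ _ h
  | mem f hf =>
    obtain ⟨⟨x, m⟩, hm, rfl⟩ := hf
    rw [act_arrow, genAct_single, one_smul, genActBasis]
    split_ifs
    exacts [single_mem_degreeLT (sub_lt_sub_right hm 1) _, zero_mem _]

end PathModule

/-! ### Paths ending at a fixed vertex, filtered by length -/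

section Words

variable {K : Type w} [Field K] {V : Type u} [Quiver.{v} V]

variable (K) in
/-- The products of `n` arrows and the vertex `a`, in this order. They are zero or represent
paths of length `n` that end in `a`. -/
inductive IsWord (a : V) : ℕ → LeavittPathAlgebra K V → Prop
  | nil : IsWord a 0 (vertex K a)
  | cons (e : Quiver.Total V) {n : ℕ} {x : LeavittPathAlgebra K V} (h : IsWord a n x) :
      IsWord a (n + 1) (arrow K e * x)

theorem IsWord.mul_vertex {a : V} {n : ℕ} {x : LeavittPathAlgebra K V} (h : IsWord K a n x) :
    x * vertex K a = x := by
  induction h with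
  | nil => exact vertex_mul_self K a
  | cons e _ ih => rw [mul_assoc, ih]

theorem IsWord.vertex_mul {a : V} {n : ℕ} {x : LeavittPathAlgebra K V} (h : IsWord K a n x)
    (b : V) : vertex K b * x = x ∨ vertex K b * x = 0 := by
  cases h with
  | nil =>
    by_cases hb : b = a
    · subst hb; exact .inl (vertex_mul_self K b)
    · exact .inr (vertex_mul_ne K hb)
  | cons e _ =>
    by_cases hb : b = e.left
    · subst hb; exact .inl (by rw [← mul_assoc, source_mul_arrow])
    · exact .inr (by rw [← mul_assoc, vertex_mul_arrow_ne K hb, zero_mul])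

theorem IsWord.mul_arrow {e : Quiver.Total V} {n : ℕ} {x : LeavittPathAlgebra K V}
    (h : IsWord K e.left n x) : IsWord K e.right (n + 1) (x * arrow K e) := by
  generalize ha : e.left = a at h
  induction h with
  | nil =>
    subst ha
    rw [source_mul_arrow, ← arrow_mul_range]
    exact .cons e .nil
  | cons f _ ih =>
    rw [mul_assoc]
    exact .cons f ih

variable (K) in
/-- The span of the words of length at least `n` that end in `a`. -/
noncomputable def wordsGE (a : V) (n : ℕ) : Submodule K (LeavittPathAlgebra K V) :=
  Submodule.span K {x | ∃ m, n ≤ m ∧ IsWord K a m x}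

variable (K) in
/-- The span of the words of length less than `n` that end in `a`. -/
noncomputable def wordsLT (a : V) (n : ℕ) : Submodule K (LeavittPathAlgebra K V) :=
  Submodule.span K {x | ∃ m < n, IsWord K a m x}

theorem IsWord.mem_wordsGE {a : V} {m n : ℕ} {x : LeavittPathAlgebra K V} (h : IsWord K a m x)
    (hn : n ≤ m) : x ∈ wordsGE K a n :=
  Submodule.subset_span ⟨m, hn, h⟩

theorem IsWord.mem_wordsLT {a : V} {m n : ℕ} {x : LeavittPathAlgebra K V} (h : IsWord K a m x)
    (hn : m < n) : x ∈ wordsLT K a n :=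
  Submodule.subset_span ⟨m, hn, h⟩

theorem wordsGE_anti (a : V) {m n : ℕ} (h : m ≤ n) : wordsGE K a n ≤ wordsGE K a m :=
  Submodule.span_mono fun _ ⟨l, hl, hx⟩ => ⟨l, h.trans hl, hx⟩

theorem wordsLT_mono (a : V) {m n : ℕ} (h : m ≤ n) : wordsLT K a m ≤ wordsLT K a n :=
  Submodule.span_mono fun _ ⟨l, hl, hx⟩ => ⟨l, hl.trans_le h, hx⟩

theorem mul_mem_of_mem_span {S : Set (LeavittPathAlgebra K V)}
    {T : Submodule K (LeavittPathAlgebra K V)} {a x : LeavittPathAlgebra K V}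
    (hx : x ∈ Submodule.span K S) (h : ∀ y ∈ S, a * y ∈ T) : a * x ∈ T :=
  (Submodule.span_le (p := T.comap (LinearMap.mulLeft K a))).2 h hx

theorem mem_mul_of_mem_span {S : Set (LeavittPathAlgebra K V)}
    {T : Submodule K (LeavittPathAlgebra K V)} {a x : LeavittPathAlgebra K V}
    (hx : x ∈ Submodule.span K S) (h : ∀ y ∈ S, y * a ∈ T) : x * a ∈ T :=
  (Submodule.span_le (p := T.comap (LinearMap.mulRight K a))).2 h hx

theorem exists_mem_wordsLT {a : V} {x : LeavittPathAlgebra K V} (hx : x ∈ wordsGE K a 0) :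
    ∃ n, x ∈ wordsLT K a n := by
  induction hx using Submodule.span_induction with
  | mem x hx =>
    obtain ⟨m, -, h⟩ := hx
    exact ⟨m + 1, h.mem_wordsLT m.lt_succ_self⟩
  | zero => exact ⟨0, zero_mem _⟩
  | add x y _ _ hx hy =>
    obtain ⟨m, hm⟩ := hx
    obtain ⟨n, hn⟩ := hy
    exact ⟨max m n, add_mem (wordsLT_mono a (le_max_left m n) hm)
      (wordsLT_mono a (le_max_right m n) hn)⟩
  | smul k x _ hx =>
    obtain ⟨m, hm⟩ := hx
    exact ⟨m, Submodule.smul_mem _ k hm⟩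

/-- For `e = f` the product is the range of `e` times `x`, which vanishes if `x` does not start
there. -/
theorem IsWord.ghost_mul_arrow_mul {a : V} {n : ℕ} {x : LeavittPathAlgebra K V}
    (h : IsWord K a n x) (e f : Quiver.Total V) :
    ghost K e * (arrow K f * x) = x ∨ ghost K e * (arrow K f * x) = 0 := by
  rw [← mul_assoc]
  by_cases hef : e = f
  · subst hef
    rw [ghost_mul_arrow_self]
    exact h.vertex_mul _
  · rw [ghost_mul_arrow_ne K hef, zero_mul]
    exact .inr rfl

theorem vertex_mul_mem_wordsGE {a : V} {n : ℕ} {x : LeavittPathAlgebra K V}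
    (hx : x ∈ wordsGE K a n) (b : V) : vertex K b * x ∈ wordsGE K a n := by
  refine mul_mem_of_mem_span hx ?_
  rintro y ⟨m, hm, hy⟩
  rcases hy.vertex_mul b with h | h <;> rw [h]
  exacts [hy.mem_wordsGE hm, zero_mem _]

theorem arrow_mul_mem_wordsGE {a : V} {n : ℕ} {x : LeavittPathAlgebra K V}
    (hx : x ∈ wordsGE K a n) (e : Quiver.Total V) : arrow K e * x ∈ wordsGE K a (n + 1) := by
  refine mul_mem_of_mem_span hx ?_
  rintro y ⟨m, hm, hy⟩
  exact (hy.cons e).mem_wordsGE (Nat.succ_le_succ hm)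

theorem ghost_mul_mem_wordsGE {a : V} {n : ℕ} {x : LeavittPathAlgebra K V}
    (hx : x ∈ wordsGE K a (n + 1)) (e : Quiver.Total V) : ghost K e * x ∈ wordsGE K a n := by
  refine mul_mem_of_mem_span hx ?_
  rintro _ ⟨m, hm, hy⟩
  cases hy with
  | nil => omega
  | cons f hy =>
    rcases hy.ghost_mul_arrow_mul e f with h | h <;> rw [h]
    exacts [hy.mem_wordsGE (Nat.le_of_succ_le_succ hm), zero_mem _]

theorem mul_arrow_mem_wordsGE {e : Quiver.Total V} {n : ℕ} {x : LeavittPathAlgebra K V}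
    (hx : x ∈ wordsGE K e.left n) : x * arrow K e ∈ wordsGE K e.right (n + 1) := by
  refine mem_mul_of_mem_span hx ?_
  rintro y ⟨m, hm, hy⟩
  exact hy.mul_arrow.mem_wordsGE (Nat.succ_le_succ hm)

/-- Left multiplication by a fixed element shortens words by a bounded amount. -/
theorem exists_mul_mem_wordsGE (x : LeavittPathAlgebra K V) :
    ∃ N, ∀ (a : V) (n : ℕ), ∀ y ∈ wordsGE K a (n + N), x * y ∈ wordsGE K a n := by
  induction x using leavitt_induction with
  | hvertex b => exact ⟨0, fun a n y hy => vertex_mul_mem_wordsGE hy b⟩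
  | harrow e =>
    exact ⟨0, fun a n y hy => wordsGE_anti a n.le_succ (arrow_mul_mem_wordsGE hy e)⟩
  -- Only ghost arrows shorten words, each by at most one.
  | hghost e => exact ⟨1, fun a n y hy => ghost_mul_mem_wordsGE hy e⟩
  | hzero => exact ⟨0, fun a n y _ => by rw [zero_mul]; exact zero_mem _⟩
  | hadd x x' hx hx' =>
    obtain ⟨M, hM⟩ := hx
    obtain ⟨N, hN⟩ := hx'
    refine ⟨max M N, fun a n y hy => ?_⟩
    rw [add_mul]
    exact add_mem (hM a n y (wordsGE_anti a (by omega) hy))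
      (hN a n y (wordsGE_anti a (by omega) hy))
  | hmul x x' hx hx' =>
    obtain ⟨M, hM⟩ := hx
    obtain ⟨N, hN⟩ := hx'
    refine ⟨M + N, fun a n y hy => ?_⟩
    rw [mul_assoc]
    exact hM a n _ (hN a _ y (by rwa [add_assoc]))
  | hsmul k x hx =>
    obtain ⟨M, hM⟩ := hx
    refine ⟨M, fun a n y hy => ?_⟩
    rw [smul_mul_assoc]
    exact Submodule.smul_mem _ k (hM a n y hy)

theorem RowFinite.finite_total [Finite V] (hrow : RowFinite V) : Finite (Quiver.Total V) := by
  have : ∀ a : V, Finite (Quiver.Star a) := hrow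
  exact Finite.of_surjective (fun p : Σ a : V, Quiver.Star a => starArrow p.2)
    fun ⟨a, b, e⟩ => ⟨⟨a, b, e⟩, rfl⟩

/-- A nonzero combination of paths that end in the vertex `a` has a left multiple that is a
nonzero multiple of `a` up to longer paths. -/
theorem exists_mul_sub_smul_vertex_mem [Finite V] (hrow : RowFinite V)
    (I : TwoSidedIdeal (LeavittPathAlgebra K V)) (a : V) (n : ℕ) (p : LeavittPathAlgebra K V)
    (hp : p ∈ wordsLT K a n) (hpI : p ∉ I) :
    ∃ (y : LeavittPathAlgebra K V) (k : K), k ≠ 0 ∧ y * p - k • vertex K a ∈ wordsGE K a 1 := by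
  classical
  have := hrow.finite_total
  have := Fintype.ofFinite (Quiver.Total V)
  induction n generalizing p with
  | zero =>
    refine absurd ?_ hpI
    have : p = 0 := by simpa [wordsLT] using hp
    rw [this]
    exact I.zero_mem
  | succ n ih =>
    -- `E` collects the words of positive length, so that `p` splits into a multiple of `a` and an
    -- element of `E`.
    let E := Submodule.span K {y | ∃ m < n, ∃ (e : Quiver.Total V) (x : LeavittPathAlgebra K V),
      IsWord K a m x ∧ y = arrow K e * x}
    have hle : wordsLT K a (n + 1) ≤ Submodule.span K {vertex K a} ⊔ E := by
      refine Submodule.span_le.2 ?_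
      rintro y ⟨m, hm, hy⟩
      cases hy with
      | nil => exact Submodule.mem_sup_left (Submodule.mem_span_singleton_self _)
      | cons e hy =>
        exact Submodule.mem_sup_right (Submodule.subset_span ⟨_, by omega, e, _, hy, rfl⟩)
    have hE : E ≤ wordsGE K a 1 := by
      refine Submodule.span_le.2 ?_
      rintro _ ⟨m, -, e, x, hx, rfl⟩
      exact (hx.cons e).mem_wordsGE (by omega)
    obtain ⟨_, hk, p', hp', rfl⟩ := Submodule.mem_sup.1 (hle hp)
    obtain ⟨k, rfl⟩ := Submodule.mem_span_singleton.1 hk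
    by_cases hk0 : k = 0
    · subst hk0
      rw [zero_smul, zero_add] at hpI ⊢
      -- The sum of all `e e*` is a left unit on words that begin with an arrow. Hence, if `p` has
      -- no term at `a`, some `e*` keeps it outside `I` while shortening every word.
      have hsum : ∀ z ∈ E, (∑ e : Quiver.Total V, arrow K e * ghost K e) * z = z := by
        intro z hz
        induction hz using Submodule.span_induction with
        | mem z hz =>
          obtain ⟨m, -, f, x, hx, rfl⟩ := hz
          rw [Finset.sum_mul, Finset.sum_eq_single f, mul_assoc, ← mul_assoc (ghost K f),
            ghost_mul_arrow_self, ← mul_assoc, arrow_mul_range]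
          · intro e _ hef
            rw [mul_assoc, ← mul_assoc (ghost K e), ghost_mul_arrow_ne K hef, zero_mul, mul_zero]
          · simp
        | zero => rw [mul_zero]
        | add x y _ _ hx hy => rw [mul_add, hx, hy]
        | smul k x _ hx => rw [mul_smul_comm, hx]
      obtain ⟨e, he⟩ : ∃ e, ghost K e * p' ∉ I := by
        by_contra! h
        rw [← hsum p' hp', Finset.sum_mul] at hpI
        exact hpI (sum_mem fun e _ => by rw [mul_assoc]; exact I.mul_mem_left _ _ (h e))
      obtain ⟨y, k, hk, hy⟩ := ih (ghost K e * p') (mul_mem_of_mem_span hp' (by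
        rintro _ ⟨m, hm, f, x, hx, rfl⟩
        rcases hx.ghost_mul_arrow_mul e f with h | h <;> rw [h]
        exacts [hx.mem_wordsLT hm, zero_mem _])) he
      exact ⟨y * ghost K e, k, hk, by rwa [mul_assoc]⟩
    · refine ⟨vertex K a, k, hk0, ?_⟩
      rw [mul_add, mul_smul_comm, vertex_mul_self, add_sub_cancel_left]
      exact vertex_mul_mem_wordsGE (hE hp') a

end Words

/-! ### Vertices in the socle -/

section Socle

variable {K : Type w} [Field K] {V : Type u} [Quiver.{v} V]

/-- No arrow starts at a sink, so every ghost arrow kills the vertex `a`; the left ideal generated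
by `a` is spanned by genuine paths. -/
theorem mul_mem_wordsGE_of_sink {a : V} (ha : IsEmpty (Quiver.Star a))
    (x : LeavittPathAlgebra K V) : ∀ y ∈ wordsGE K a 0, x * y ∈ wordsGE K a 0 := by
  induction x using leavitt_induction with
  | hvertex b => exact fun y hy => vertex_mul_mem_wordsGE hy b
  | harrow e =>
    exact fun y hy => wordsGE_anti a (Nat.zero_le 1) (arrow_mul_mem_wordsGE hy e)
  | hghost e =>
    refine fun y hy => mul_mem_of_mem_span hy ?_
    rintro _ ⟨m, -, hy⟩
    cases hy with
    | nil =>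
      rw [ghost_mul_vertex_ne K]
      · exact zero_mem _
      · rintro rfl
        exact ha.elim ⟨_, e.hom⟩
    | cons f hy =>
      rcases hy.ghost_mul_arrow_mul e f with h | h <;> rw [h]
      exacts [hy.mem_wordsGE (Nat.zero_le _), zero_mem _]
  | hzero => exact fun y _ => by rw [zero_mul]; exact zero_mem _
  | hadd x x' hx hx' => exact fun y hy => by rw [add_mul]; exact add_mem (hx y hy) (hx' y hy)
  | hmul x x' hx hx' => exact fun y hy => by rw [mul_assoc]; exact hx _ (hx' y hy)
  | hsmul k x hx =>
    exact fun y hy => by rw [smul_mul_assoc]; exact Submodule.smul_mem _ k (hx y hy)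

/-- Sinks lie in the socle of the Leavitt path algebra. -/
theorem vertex_mem_socle_of_sink [Finite V] (hrow : RowFinite V) {a : V}
    (ha : IsEmpty (Quiver.Star a)) : vertex K a ∈ socle (LeavittPathAlgebra K V) := by
  by_cases h0 : vertex K a = 0
  · rw [h0]
    exact TwoSidedIdeal.zero_mem _
  rw [mem_socle]
  let M : AddSubgroup (LeavittPathAlgebra K V) := (AddMonoidHom.mulRight (vertex K a)).range
  have haM : vertex K a ∈ M := ⟨vertex K a, vertex_mul_self K a⟩
  -- The sink `a` kills every longer path from the left, so the error term of the reduction below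
  -- disappears.
  have hvz : ∀ y ∈ wordsGE K a 1, vertex K a * y = 0 := by
    intro y hy
    refine (Submodule.mem_bot K).1 (mul_mem_of_mem_span hy ?_)
    rintro _ ⟨m, hm, hy⟩
    cases hy with
    | nil => omega
    | cons e hy =>
      rw [← mul_assoc, vertex_mul_arrow_ne K, zero_mul]
      · exact zero_mem _
      · rintro rfl
        exact ha.elim ⟨_, e.hom⟩
  suffices hM : IsMinimalLeftIdeal M from
    (le_sSup (a := M) hM : M ≤ socleAddSubgroup (LeavittPathAlgebra K V)) haM
  refine ⟨⟨?_, ?_⟩, ?_⟩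
  · rintro b _ ⟨y, rfl⟩
    exact ⟨b * y, by simp [mul_assoc]⟩
  · intro hbot
    rw [hbot, AddSubgroup.mem_bot] at haM
    exact h0 haM
  · rintro N ⟨hN, hN0⟩ hNM
    obtain ⟨p, hpN, hp0⟩ := N.bot_or_exists_ne_zero.resolve_left hN0
    obtain ⟨z, hz⟩ := hNM hpN
    have hp : p ∈ wordsGE K a 0 := by
      rw [← hz]
      exact mul_mem_wordsGE_of_sink ha z _ (IsWord.nil.mem_wordsGE le_rfl)
    obtain ⟨n, hpn⟩ := exists_mem_wordsLT hp
    obtain ⟨y, k, hk, hy⟩ := exists_mul_sub_smul_vertex_mem hrow ⊥ a n p hpn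
      (by rwa [TwoSidedIdeal.mem_bot])
    have hkv : vertex K a * (y * p) = k • vertex K a := by
      have := hvz _ hy
      rwa [mul_sub, mul_smul_comm, vertex_mul_self, sub_eq_zero] at this
    have haN : vertex K a ∈ N := by
      rw [← inv_smul_smul₀ hk (vertex K a), ← hkv]
      exact hN.smul_mem _ (hN _ _ (hN _ _ hpN))
    rintro _ ⟨b, rfl⟩
    exact hN b _ haN

/-- The vertices of a two-sided ideal of the Leavitt path algebra form a saturated set. -/
theorem isSaturated_vertex_mem (I : TwoSidedIdeal (LeavittPathAlgebra K V)) :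
    IsSaturated {a : V | vertex K a ∈ I} := by
  rintro a ⟨hne, hfin⟩ h
  have := Fintype.ofFinite (Quiver.Star a)
  change vertex K a ∈ I
  rw [vertex_eq_sum K a hne]
  refine sum_mem fun p _ => ?_
  rw [← arrow_mul_range]
  exact I.mul_mem_right _ _ (I.mul_mem_left _ _ (h p.1 p.2))

/-- A vertex from which no infinite path starts lies in the socle. -/
theorem vertex_mem_socle [Finite V] (hrow : RowFinite V) {a : V}
    (ha : ∀ x : InfPath V, x.head.left ≠ a) : vertex K a ∈ socle (LeavittPathAlgebra K V) := by
  by_contra h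
  -- The vertices in the socle are saturated and contain the sinks, so outside them one can walk
  -- forever.
  obtain ⟨f, rfl, hf⟩ := exists_seq_of_forall_exists_arrow
    (S := {a : V | vertex K a ∈ socle (LeavittPathAlgebra K V)}ᶜ)
    (fun b hb => (isSaturated_vertex_mem (socle (LeavittPathAlgebra K V))).exists_arrow hrow
      (fun c hc => vertex_mem_socle_of_sink hrow hc) hb) h
  exact ha ⟨fun n => ⟨f n, f (n + 1), (hf n).some⟩, fun _ => rfl⟩ rfl

end Socle

/-! ### Periodic paths and injectivity of the action -/

section Periodic

variable {K : Type w} [Field K] {V : Type u} [Quiver.{v} V]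

theorem InfPath.iterate_tail_apply (x : InfPath V) (m n : ℕ) :
    (InfPath.tail^[m] x).1 n = x.1 (n + m) := by
  induction m generalizing x with
  | zero => rfl
  | succ m ih =>
    rw [Function.iterate_succ_apply, ih]
    exact congrArg x.1 (by omega)

/-- In a finite quiver every infinite path reaches a vertex at which a periodic path starts. -/
theorem InfPath.exists_periodic [Finite V] (x : InfPath V) :
    ∃ (i m : ℕ) (y : InfPath V), 0 < m ∧ (InfPath.tail^[i] x).head.left = y.head.left ∧
      InfPath.tail^[m] y = y := by
  obtain ⟨i, j, hij, heq⟩ : ∃ i j, i < j ∧ (x.1 i).left = (x.1 j).left := by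
    obtain ⟨a, b, hab, heq⟩ := Finite.exists_ne_map_eq_of_infinite fun n => (x.1 n).left
    rcases lt_or_gt_of_ne hab with hlt | hlt
    · exact ⟨a, b, hlt, heq⟩
    · exact ⟨b, a, hlt, heq.symm⟩
  have hm : 0 < j - i := by omega
  -- The arrows of `x` from index `i` to `j - 1`, repeated forever.
  let y : InfPath V := ⟨fun n => x.1 (i + n % (j - i)), fun n => by
    have hlt := Nat.mod_lt n hm
    rw [x.2]
    change (x.1 (i + n % (j - i) + 1)).left = (x.1 (i + (n + 1) % (j - i))).left
    rw [← Nat.mod_add_mod n (j - i) 1]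
    rcases Nat.lt_or_ge (n % (j - i) + 1) (j - i) with h | h
    · rw [Nat.mod_eq_of_lt h, add_assoc]
    · have h' : n % (j - i) + 1 = j - i := by omega
      rw [h', Nat.mod_self, add_assoc, h', Nat.add_sub_cancel' hij.le]
      exact heq.symm⟩
  refine ⟨i, j - i, y, hm, ?_, ?_⟩
  · rw [InfPath.head, InfPath.iterate_tail_apply]
    simp [y, InfPath.head]
  · apply Subtype.ext
    funext n
    rw [InfPath.iterate_tail_apply]
    simp [y]

variable (K) in
/-- The product of the first `n` arrows of an infinite path, in the Leavitt path algebra. -/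
noncomputable def InfPath.word : ℕ → InfPath V → LeavittPathAlgebra K V
  | 0, x => vertex K x.head.left
  | n + 1, x => arrow K x.head * InfPath.word n x.tail

theorem InfPath.isWord_word (n : ℕ) (x : InfPath V) :
    IsWord K (InfPath.tail^[n] x).head.left n (x.word K n) := by
  induction n generalizing x with
  | zero => exact .nil
  | succ n ih => exact .cons _ (ih x.tail)

theorem coeffSum_act_word (n : ℕ) (x : InfPath V) (f : PathModule V K) :
    coeffSum K (InfPath.tail^[n] x) (act (x.word K n) f) = coeffSum K x f := by
  induction n generalizing x f with
  | zero => exact coeffSum_act_vertex x f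
  | succ n ih =>
    rw [InfPath.word, act_mul, Function.iterate_succ_apply, ih, coeffSum_tail_act_arrow_head]

theorem act_word_single (n : ℕ) (x : InfPath V) (d : ℤ) (k : K) :
    act (x.word K n) (Finsupp.single (x, d) k) =
      Finsupp.single (InfPath.tail^[n] x, d - n) k := by
  induction n generalizing x d with
  | zero => simp [InfPath.word, act_vertex_single]
  | succ n ih =>
    rw [InfPath.word, act_mul, act_arrow_head_single, ih, Function.iterate_succ_apply]
    push_cast
    rw [sub_sub, add_comm (1 : ℤ)]

theorem IsWord.act_mem_degreeLT {a : V} {m : ℕ} {x : LeavittPathAlgebra K V}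
    (h : IsWord K a m x) {n : ℤ} {f : PathModule V K} (hf : f ∈ degreeLT V K n) :
    act x f ∈ degreeLT V K (n - m) := by
  induction h generalizing n f with
  | nil => simpa using act_vertex_mem_degreeLT a hf
  | cons e _ ih =>
    rw [act_mul]
    have := ih (act_arrow_mem_degreeLT e hf)
    push_cast
    rwa [add_comm, ← sub_sub]

theorem act_mem_degreeLT_of_mem_wordsGE {a : V} {m : ℕ} {x : LeavittPathAlgebra K V}
    (hx : x ∈ wordsGE K a m) {n : ℤ} {f : PathModule V K} (hf : f ∈ degreeLT V K n) :
    act x f ∈ degreeLT V K (n - m) := by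
  induction hx using Submodule.span_induction with
  | mem x hx =>
    obtain ⟨l, hl, h⟩ := hx
    exact degreeLT_mono (by omega) (h.act_mem_degreeLT hf)
  | zero => rw [act_zero]; exact zero_mem _
  | add x y _ _ hx hy => rw [act_add]; exact add_mem hx hy
  | smul k x _ hx => rw [act_smul]; exact Submodule.smul_mem _ k hx

/-- An element that is a nonzero multiple of the vertex `a` up to longer paths acts injectively
on the part of the path module that belongs to `a`. -/
theorem eq_zero_of_act_eq_zero {a : V} {q : LeavittPathAlgebra K V} {k : K} (hk : k ≠ 0)
    (hq : q - k • vertex K a ∈ wordsGE K a 1) {f : PathModule V K}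
    (hf : act (vertex K a) f = f) (h0 : act q f = 0) : f = 0 := by
  -- From `act q f = 0`, the vector `k • f` is minus the image of `f` under longer paths, whose
  -- degrees are lower by at least one.
  have hstep : ∀ n : ℤ, f ∈ degreeLT V K n → f ∈ degreeLT V K (n - 1) := by
    intro n hn
    have h1 := act_mem_degreeLT_of_mem_wordsGE hq hn
    rw [act_sub, act_smul, LinearMap.sub_apply, LinearMap.smul_apply, hf, h0, zero_sub] at h1
    exact (Submodule.smul_mem_iff _ hk).1 (neg_mem_iff.1 h1)
  obtain ⟨n, hn⟩ := exists_mem_degreeLT f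
  have hall : ∀ j : ℕ, f ∈ degreeLT V K (n - j) := by
    intro j
    induction j with
    | zero => simpa using hn
    | succ j ih =>
      have := hstep _ ih
      push_cast
      rwa [← sub_sub]
  exact eq_zero_of_forall_mem_degreeLT fun m =>
    degreeLT_mono (by omega) (hall ((n : ℤ) - m).toNat)

end Periodic

/-! ### No minimal left ideals modulo the socle -/

section Loewy

variable {K : Type w} [Field K] {V : Type u} [Quiver.{v} V]

/-- The image of `b` modulo `I` is nonzero and generated by each of its nonzero multiples. -/
def IsMinimalModulo {A : Type w} [NonUnitalRing A] (I : TwoSidedIdeal A) (b : A) : Prop :=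
  b ∉ I ∧ ∀ r, r * b ∉ I → ∃ y, y * (r * b) - b ∈ I

theorem IsMinimalModulo.mul_left {A : Type w} [NonUnitalRing A] {I : TwoSidedIdeal A} {b : A}
    (hb : IsMinimalModulo I b) {a : A} (hab : a * b ∉ I) : IsMinimalModulo I (a * b) := by
  refine ⟨hab, fun r hr => ?_⟩
  obtain ⟨y, hy⟩ := hb.2 (r * a) (by rwa [mul_assoc])
  refine ⟨a * y, ?_⟩
  have := I.mul_mem_left a _ hy
  simpa only [mul_sub, mul_assoc] using this

theorem IsMinimalModulo.mul_right {A : Type w} [NonUnitalRing A] {I : TwoSidedIdeal A} {b : A}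
    (hb : IsMinimalModulo I b) {a : A} (hab : b * a ∉ I) : IsMinimalModulo I (b * a) := by
  refine ⟨hab, fun r hr => ?_⟩
  obtain ⟨y, hy⟩ := hb.2 r (fun h => hr (by rw [← mul_assoc]; exact I.mul_mem_right _ _ h))
  refine ⟨y, ?_⟩
  have := I.mul_mem_right _ a hy
  simpa only [sub_mul, mul_assoc] using this

variable {I : TwoSidedIdeal (LeavittPathAlgebra K V)}

/-- Such a `q` acts injectively at the source of `x`, so it does not kill the basis vector of `x`.
-/
theorem notMem_of_sub_smul_vertex_mem (hle : I ≤ TwoSidedIdeal.ker (pathAct V K))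
    (x : InfPath V) {q : LeavittPathAlgebra K V} {k : K} (hk : k ≠ 0)
    (hq : q - k • vertex K x.head.left ∈ wordsGE K x.head.left 1) : q ∉ I := by
  intro h
  have h0 := mem_ker_pathAct.1 (hle h)
  have := eq_zero_of_act_eq_zero hk hq (act_vertex_single x 0 1) (by rw [h0]; rfl)
  simp at this

/-- Conjugation by the first arrows of an infinite path. -/
theorem IsMinimalModulo.exists_along_path (hle : I ≤ TwoSidedIdeal.ker (pathAct V K))
    (n : ℕ) (x : InfPath V) {q : LeavittPathAlgebra K V} {k : K} (hk : k ≠ 0)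
    (hq : q - k • vertex K x.head.left ∈ wordsGE K x.head.left 1) (hqI : IsMinimalModulo I q) :
    ∃ q', q' - k • vertex K (InfPath.tail^[n] x).head.left ∈
        wordsGE K (InfPath.tail^[n] x).head.left 1 ∧ IsMinimalModulo I q' := by
  induction n generalizing x q with
  | zero => exact ⟨q, hq, hqI⟩
  | succ n ih =>
    -- The arrow on the right lengthens the error terms by one and the ghost arrow on the left
    -- shortens them by one; the leading vertex moves one step along `x`.
    have h1 : ghost K x.head * (q * arrow K x.head) - k • vertex K x.tail.head.left ∈
        wordsGE K x.tail.head.left 1 := by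
      have := ghost_mul_mem_wordsGE (mul_arrow_mem_wordsGE hq) x.head
      rwa [sub_mul, mul_sub, smul_mul_assoc, source_mul_arrow, mul_smul_comm,
        ghost_mul_arrow_self, x.right_head] at this
    have h2 := notMem_of_sub_smul_vertex_mem hle x.tail hk h1
    exact ih x.tail h1
      ((hqI.mul_right fun h => h2 (I.mul_mem_left _ _ h)).mul_left h2)

/-- If `b` times every arrow were in `I`, the second Cuntz–Krieger relation would put `b` times
every regular vertex in `I`; sinks are in `I` by `hI`. -/
theorem exists_isWord_mul_notMem [Finite V] (hrow : RowFinite V)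
    (hI : ∀ a : V, (∀ x : InfPath V, x.head.left ≠ a) → vertex K a ∈ I) (n : ℕ)
    {b : LeavittPathAlgebra K V} (hb : b ∉ I) :
    ∃ (a : V) (x : LeavittPathAlgebra K V), IsWord K a n x ∧ b * x ∉ I := by
  have := Fintype.ofFinite V
  have hv : ∀ {b : LeavittPathAlgebra K V}, b ∉ I → ∃ a, b * vertex K a ∉ I := by
    intro b hb
    by_contra! h
    refine hb ?_
    rw [← mul_vertexSum b, vertexSum, Finset.mul_sum]
    exact sum_mem fun a _ => h a
  induction n generalizing b with
  | zero =>
    obtain ⟨a, ha⟩ := hv hb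
    exact ⟨a, _, .nil, ha⟩
  | succ n ih =>
    obtain ⟨a, ha⟩ := hv hb
    obtain ⟨e, he⟩ : ∃ e, b * arrow K e ∉ I := by
      by_contra! h
      refine ha ?_
      by_cases hs : Nonempty (Quiver.Star a)
      · have := hrow a
        have := Fintype.ofFinite (Quiver.Star a)
        rw [vertex_eq_sum K a hs, Finset.mul_sum]
        refine sum_mem fun p _ => ?_
        rw [← mul_assoc]
        exact I.mul_mem_right _ _ (h _)
      · refine I.mul_mem_left _ _ (hI a ?_)
        rintro x rfl
        exact hs ⟨x.head.right, x.head.hom⟩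
    obtain ⟨c, x, hx, hbx⟩ := ih he
    exact ⟨c, _, hx.cons e, by rwa [← mul_assoc]⟩

/-- Modulo an ideal that contains the vertices without infinite paths and acts trivially on the
path module, the Leavitt path
algebra of a finite quiver has no minimal left ideals. -/
theorem not_isMinimalModulo [Finite V] (hrow : RowFinite V)
    (hle : I ≤ TwoSidedIdeal.ker (pathAct V K))
    (hI : ∀ a : V, (∀ x : InfPath V, x.head.left ≠ a) → vertex K a ∈ I)
    (b : LeavittPathAlgebra K V) : ¬ IsMinimalModulo I b := by
  intro hb
  -- A path of length `N` absorbs all ghost arrows of `b`, so `b * x` is a combination of genuine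
  -- paths.
  obtain ⟨N, hN⟩ := exists_mul_mem_wordsGE b
  obtain ⟨a, x, hx, hbx⟩ := exists_isWord_mul_notMem hrow hI N hb.1
  obtain ⟨n, hn⟩ := exists_mem_wordsLT (hN a 0 x (hx.mem_wordsGE (by omega)))
  obtain ⟨z, k, hk, hz⟩ := exists_mul_sub_smul_vertex_mem hrow I a n _ hn hbx
  obtain ⟨p, rfl⟩ : ∃ p : InfPath V, p.head.left = a := by
    by_contra! h
    refine hbx ?_
    rw [← hx.mul_vertex, ← mul_assoc]
    exact I.mul_mem_left _ _ (hI a h)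
  have hmin := (hb.mul_right hbx).mul_left (notMem_of_sub_smul_vertex_mem hle p hk hz)
  obtain ⟨i, m, y, hm, hiy, hper⟩ := p.exists_periodic
  obtain ⟨q, hq, hqI⟩ := hmin.exists_along_path hle i p hk hz
  rw [hiy] at hq
  have hcv : y.word K m * vertex K y.head.left = y.word K m := by
    have := (y.isWord_word (K := K) m).mul_vertex
    rwa [hper] at this
  set r := vertex K y.head.left - y.word K m with hr
  have hrv : r * vertex K y.head.left = r := by
    rw [hr, sub_mul, vertex_mul_self, hcv]
  have hfix : ∀ g : PathModule V K, act (vertex K y.head.left) (act r g) = act r g := by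
    intro g
    rw [← act_mul, hrv]
  let f : PathModule V K := Finsupp.single (y, 0) 1
  -- `r` sends `(y, 0)` to `(y, 0) - (y, -m)`. This is nonzero only because degrees are recorded,
  -- and `q` acts injectively on it.
  have hrq : r * q ∉ I := by
    intro h
    have h0 := mem_ker_pathAct.1 (hle h)
    have h1 := eq_zero_of_act_eq_zero hk hq (hfix f) (by rw [← act_mul, h0]; rfl)
    rw [hr, act_sub, LinearMap.sub_apply, act_vertex_single, act_word_single, hper,
      sub_eq_zero] at h1
    have h2 := Finsupp.single_left_injective one_ne_zero h1
    simp at h2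
    omega
  obtain ⟨t, ht⟩ := hqI.2 r hrq
  have h0 := mem_ker_pathAct.1 (hle ht)
  have h1 : act q (act r (act t f) - f) = 0 := by
    have := LinearMap.congr_fun h0 f
    rwa [act_sub, LinearMap.sub_apply, act_mul, act_mul, ← map_sub] at this
  have h2 := eq_zero_of_act_eq_zero hk hq (by
    rw [map_sub, hfix, act_vertex_single]) h1
  -- The vertex and the period both preserve the coefficient sum at `y`, so it vanishes on the image
  -- of `r`, whereas it is 1 on `f`.
  have h3 := congrArg (coeffSum K y) h2
  have h4 := coeffSum_act_word m y (act t f)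
  rw [hper] at h4
  rw [map_sub, hr, act_sub, LinearMap.sub_apply, map_sub, coeffSum_act_vertex, h4, sub_self,
    coeffSum_single, map_zero] at h3
  simp at h3

/-- Here `I` is the kernel itself: an element of a minimal left ideal that acts nontrivially would
be minimal modulo the kernel. -/
theorem socle_le_ker_pathAct [Finite V] (hrow : RowFinite V) :
    socle (LeavittPathAlgebra K V) ≤ TwoSidedIdeal.ker (pathAct V K) := by
  have := Fintype.ofFinite V
  have hle : socleAddSubgroup (LeavittPathAlgebra K V) ≤ (pathAct V K).toAddMonoidHom.ker := by
    refine sSup_le fun M hM b hb => ?_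
    by_contra hb0
    refine not_isMinimalModulo hrow le_rfl
      (fun a ha => mem_ker_pathAct.2 (act_vertex_eq_zero ha)) b ⟨hb0, fun r hr => ?_⟩
    obtain ⟨y, hy⟩ := hM.exists_mul_mul_eq vertexSum_mul hb (r := r)
      (fun h => hr (by rw [h]; exact TwoSidedIdeal.zero_mem _))
    exact ⟨y, by rw [hy, sub_self]; exact TwoSidedIdeal.zero_mem _⟩
  exact fun x hx => hle ((mem_socle _).1 hx)

/-- The Loewy series of the Leavitt path algebra of a finite quiver stops at the socle. -/
theorem socleOver_socle [Finite V] (hrow : RowFinite V) :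
    socleOver (socle (LeavittPathAlgebra K V)) = socle (LeavittPathAlgebra K V) := by
  have := Fintype.ofFinite V
  refine socleOver_eq_self fun M hM => ?_
  obtain ⟨c, hc, hc0⟩ := M.bot_or_exists_ne_zero.resolve_left hM.1.2
  obtain ⟨b, rfl⟩ := quotientMap_surjective _ c
  refine not_isMinimalModulo hrow (socle_le_ker_pathAct hrow)
    (fun a ha => vertex_mem_socle hrow ha) b
    ⟨fun h => hc0 (quotientMap_eq_zero_iff.2 h), fun r hr => ?_⟩
  obtain ⟨y, hy⟩ := hM.exists_mul_mul_eq (one := quotientMap _ (vertexSum K V)) (fun a => by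
    obtain ⟨a, rfl⟩ := quotientMap_surjective _ a
    rw [← map_mul, vertexSum_mul]) hc (r := quotientMap _ r)
    (fun h => hr (quotientMap_eq_zero_iff.1 (by rwa [map_mul])))
  obtain ⟨y, rfl⟩ := quotientMap_surjective _ y
  exact ⟨y, quotientMap_eq_zero_iff.1 (by rw [map_sub, map_mul, map_mul, hy, sub_self])⟩

end Loewy

end LeavittQuiver

theorem proposition4 (K : Type*) [Field K] (V : Type*) [Quiver V]
    (hrow : LeavittQuiver.RowFinite V) :
    (∀ u ∈ LeavittQuiver.linePointsOff (LeavittQuiver.hsClosure (LeavittQuiver.linePoints V)),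
      ∃ (w : V) (_ : u ⟶ w),
        w ∉ LeavittQuiver.hsClosure (LeavittQuiver.linePoints V) ∧ w ≠ u) ∧
    (∀ (k : ℕ) (u : Fin (k + 1) → V), Function.Injective u →
      (∀ i, u i ∉ LeavittQuiver.hsClosure (LeavittQuiver.linePoints V)) →
      (∀ i : Fin k, Nonempty (u i.castSucc ⟶ u i.succ)) →
      u 0 ∈ LeavittQuiver.linePointsOff (LeavittQuiver.hsClosure (LeavittQuiver.linePoints V)) →
      ∃ w : V, w ∉ Set.range u ∧ w ∉ LeavittQuiver.hsClosure (LeavittQuiver.linePoints V) ∧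
        Nonempty (u (Fin.last k) ⟶ w)) ∧
    (Finite V →
      LeavittQuiver.linePointsOff (LeavittQuiver.hsClosure (LeavittQuiver.linePoints V)) = ∅ ∧
      LeavittQuiver.linePointUnion V = LeavittQuiver.linePointSeries V 1 ∧
      LeavittQuiver.socleSeries (LeavittQuiver.LeavittPathAlgebra K V) 2 =
        LeavittQuiver.socleSeries (LeavittQuiver.LeavittPathAlgebra K V) 1 ∧
      LeavittQuiver.socleSum (LeavittQuiver.LeavittPathAlgebra K V) =
        LeavittQuiver.socleSeries (LeavittQuiver.LeavittPathAlgebra K V) 1) := by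
  refine ⟨fun u hu => ?_, fun k u hinj hu harr h0 =>
    LeavittQuiver.exists_arrow_notMem_range hrow k u hinj hu harr h0, fun hfin => ?_⟩
  · obtain ⟨a, -, rfl⟩ := id hu
    -- Part (1) is part (2) for the sequence with the single vertex `a`.
    obtain ⟨w, hw, hwH, ⟨e⟩⟩ := LeavittQuiver.exists_arrow_notMem_range hrow 0 (fun _ => a.1)
      (fun i j _ => Fin.ext (by omega)) (fun _ => a.2) (fun i => i.elim0) hu
    exact ⟨w, e, hwH, fun h => hw ⟨0, h.symm⟩⟩
  · have hempty := LeavittQuiver.linePointsOff_hsClosure_linePoints_eq_empty hrow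
    have hsoc := LeavittQuiver.socleOver_socle (K := K) hrow
    exact ⟨hempty, LeavittQuiver.linePointUnion_eq_series_one V hempty,
      LeavittQuiver.socleSeries_two_eq_one _ hsoc, LeavittQuiver.socleSum_eq_series_one _ hsoc⟩
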